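/- **Setting.** Let $n\ge 1$ and let $\mathcal S=\mathcal S_1\times\cdots\times\mathcal S_p$ with $\mathcal S_i=\mathbb R^{m_i\times n_i}$, equipped with the trace inner product $\langle\cdot,\cdot\rangle$ and its Euclidean (Frobenius) norm $\|\cdot\|_2$. Each $\mathcal S_i$ also carries an arbitrary norm $\|\cdot\|_{(i)}$ with dual norm $\|G\|_{(i)\star}=\sup_{\|Z\|_{(i)}\le 1}\langle G,Z\rangle$, and $\underline\rho_i,\bar\rho_i>0$ satisfy $\underline\rho_i\|X\|_{(i)}\le\|X\|_2\le\bar\rho_i\|X\|_{(i)}$ for all $X\in\mathcal S_i$. Let $f_1,\dots,f_n:\mathcal S\to\mathbb R$ be differentiable, $f=\frac1n\sum_{j=1}^n f_j$, and let $\nabla_i$ denote the $i$-th block of the gradient. Assume: * $f(X)\ge f^\star$ for all $X\in\mathcal S$, where $f^\star\in\mathbb R$; * (layer-wise smoothness) there are constants $L_i^0,L_{i,j}^0\ge 0$ such that, for all $i,j$ and all $X,Y\in\mathcal S$, $\|\nabla_i f(X)-\nabla_i f(Y)\|_{(i)\star}\le L_i^0\|X_i-Y_i\|_{(i)}$ and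 $\|\nabla_i f_j(X)-\nabla_i f_j(Y)\|_{(i)\star}\le L_{i,j}^0\|X_i-Y_i\|_{(i)}$; put $(\tilde L_i^0)^2=\frac1n\sum_{j=1}^n(L_{i,j}^0)^2$; * (stochastic gradients) $\mathbb E_{\xi\sim\mathcal D_j}[\nabla f_j(X;\xi)]=\nabla f_j(X)$ and $\mathbb E_{\xi\sim\mathcal D_j}\|\nabla_i f_j(X;\xi)-\nabla_i f_j(X)\|_2^2\le\sigma_i^2$ for all $X,i,j$, where $\sigma_i\ge 0$. **Algorithm (EF21-Muon).** Let $G^\sharp\in\arg\max_{X\in\mathcal S_i}\{\langle G,X\rangle-\frac12\|X\|_{(i)}^2\}$ be a (measurable) sharp operator of $\|\cdot\|_{(i)}$. Let $W^0=X^0\in\mathcal S$ be deterministic, and let the initial $M_j^0,G_j^0\in\mathcal S$ be possibly random and square integrable. Put $M_i^k=\frac1n\sum_j M_{i,j}^k$ and $G_i^k=\frac1n\sum_j G_{i,j}^k$. For $k=0,1,\dots$ and all $i,j$, $$X_i^{k+1}=X_i^k-\gamma_i(G_i^k)^\sharp,\qquad W_i^{k+1}=W_i^k+\mathcal C_i^k(X_i^{k+1}-W_i^k),$$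 $$M_{i,j}^{k+1}=(1-\beta_i)M_{i,j}^k+\beta_i\nabla_i f_j(W^{k+1};\xi_j^{k+1}),\qquad G_{i,j}^{k+1}=G_{i,j}^k+\mathcal C_{i,j}^k(M_{i,j}^{k+1}-G_{i,j}^k),$$ with $\xi_j^{k+1}\sim\mathcal D_j$. The possibly randomized compressors are contractive with parameters $\alpha_P,\alpha_D\in(0,1]$: $\mathbb E\|\mathcal C_i^k(X)-X\|_{(i)}^2\le(1-\alpha_P)\|X\|_{(i)}^2$ and $\mathbb E\|\mathcal C_{i,j}^k(X)-X\|_2^2\le(1-\alpha_D)\|X\|_2^2$ for all $X\in\mathcal S_i$. The initialization, the samples $\xi_j^{k+1}$, the randomness of the server compressors $(\mathcal C_i^k)_i$ of each iteration $k$ and that of the worker compressors $(\mathcal C_{i,j}^k)_{i,j}$ of each iteration $k$ are mutually independent; compressors of the same kind in the same iteration may depend on each other. **Theorem.** Let $\beta_i\in(0,1]$ and let $\gamma_i$, not all zero, satisfy $$0\le\gamma_i\le\frac1{2L_i^0+2\sqrt{\zeta_i}},\qquad i=1,\dots,p$$ (with $1/0=\infty$), where $$\zeta_i=\frac{\bar\rho_i^2}{\underline\rho_i^2}\left(\frac{12}{\beta_i^2}(L_i^0)^2+\frac{24(\beta_i+2)}{\alpha_P^2}(L_i^0)^2+\frac{36(\beta_i^2+4)}{\alpha_D^2}(\tilde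 L_i^0)^2+\frac{144\beta_i^2(2\beta_i+5)}{\alpha_P^2\alpha_D^2}(\tilde L_i^0)^2\right).$$ Then for every $K\ge 1$ the expectations on the left-hand side below are finite, and $$\frac1K\sum_{k=0}^{K-1}\sum_{i=1}^p\frac{\gamma_i}{\frac1p\sum_{l=1}^p\gamma_l}\,\mathbb E\|\nabla_i f(X^k)\|_{(i)\star}^2\le\frac1K\,\frac{4\Psi^0}{\frac1p\sum_{l=1}^p\gamma_l}+24\sum_{i=1}^p\left(\frac1n+\frac{(1-\alpha_D)\beta_i}{\alpha_D}+\frac{12\beta_i^2}{\alpha_D^2}\right)\frac{\sigma_i^2\bar\rho_i^2\beta_i\gamma_i}{\frac1p\sum_{l=1}^p\gamma_l},$$ where $$\Psi^0=f(X^0)-f^\star+\sum_{i=1}^p\frac{6\bar\rho_i^2}{\beta_i}\gamma_i\,\mathbb E\|\nabla_i f(X^0)-M_i^0\|_2^2+\sum_{i=1}^p\frac{72\bar\rho_i^2\beta_i}{\alpha_D^2}\gamma_i\,\frac1n\sum_{j=1}^n\mathbb E\|\nabla_i f_j(X^0)-M_{i,j}^0\|_2^2+\sum_{i=1}^p\frac{6\bar\rho_i^2}{\alpha_D}\gamma_i\,\frac1n\sum_{j=1}^n\mathbb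 E\|M_{i,j}^0-G_{i,j}^0\|_2^2.$$ -/

import Mathlib

open MeasureTheory ProbabilityTheory

namespace EFMuon

/-- The layer space `ℝ^{a × b}` of matrices with the trace inner product; its norm `‖·‖` is the
Frobenius (Euclidean) norm. -/
abbrev Layer (a b : ℕ) : Type := EuclideanSpace ℝ (Fin a × Fin b)

/-- The inner product of `Layer a b` is the trace inner product `tr(Xᵀ Y)`. -/
theorem Layer.inner_eq_trace {a b : ℕ} (x y : Layer a b) :
    inner ℝ x y = Matrix.trace
      ((Matrix.of fun s t => x (s, t)).transpose * (Matrix.of fun s t => y (s, t))) := by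
  simp only [PiLp.inner_apply, Matrix.trace, Matrix.diag_apply, Matrix.mul_apply,
    Matrix.transpose_apply, Matrix.of_apply, Fintype.sum_prod_type]
  rw [Finset.sum_comm]
  simp [mul_comm]

/-- The product space `S = S₁ × ⋯ × S_p` of all parameters, with the sum of the trace inner
products. -/
abbrev Params {p : ℕ} (a b : Fin p → ℕ) : Type := PiLp 2 fun i => Layer (a i) (b i)

section Norms

variable {E : Type*} [NormedAddCommGroup E] [InnerProductSpace ℝ E]

/-- The dual norm `‖x‖_⋆ = sup { ⟨x, z⟩ : N z ≤ 1 }` of a norm `N`. -/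
noncomputable def dualNorm (N : E → ℝ) (x : E) : ℝ :=
  sSup ((fun z => inner ℝ x z) '' {z | N z ≤ 1})

/-- `s` is a version of the sharp operator of `N`: for each `g`, `s g` is a maximizer of
`x ↦ ⟨g, x⟩ - N(x)² / 2`. -/
def IsSharpOperator (N : E → ℝ) (s : E → E) : Prop :=
  ∀ g, IsMaxOn (fun x => inner ℝ g x - N x ^ 2 / 2) Set.univ (s g)

/-- The randomized map `C`, whose random seed has law `ν`, is a contractive compressor with
parameter `α ∈ (0, 1]` with respect to `N`. -/
def IsContractiveCompressor [MeasurableSpace E] {Θ : Type*} [MeasurableSpace Θ] (ν : Measure Θ)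
    (N : E → ℝ) (α : ℝ) (C : E → Θ → E) : Prop :=
  (0 < α ∧ α ≤ 1) ∧ Measurable (Function.uncurry C) ∧
    ∀ x, Integrable (fun θ => N (C x θ - x) ^ 2) ν ∧
      ∫ θ, N (C x θ - x) ^ 2 ∂ν ≤ (1 - α) * N x ^ 2

end Norms

section Problem

variable {n p : ℕ} {a b : Fin p → ℕ}

/-- The `i`-th block `∇_i f(x)` of the gradient. -/
noncomputable def blockGrad (f : Params a b → ℝ) (i : Fin p) (x : Params a b) :
    Layer (a i) (b i) :=
  gradient f x i

/-- `f = (1/n) ∑_j f_j`. -/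
noncomputable def avgLoss (f : Fin n → Params a b → ℝ) (x : Params a b) : ℝ :=
  (n : ℝ)⁻¹ * ∑ j, f j x

/-- Layer-wise smoothness of `f` with constants `L_i ≥ 0` with respect to the layer norms `N_i`. -/
def LayerwiseSmooth (N : ∀ i, Seminorm ℝ (Layer (a i) (b i))) (L : Fin p → ℝ)
    (f : Params a b → ℝ) : Prop :=
  Differentiable ℝ f ∧ ∀ i, 0 ≤ L i ∧
    ∀ x y, dualNorm (N i) (blockGrad f i x - blockGrad f i y) ≤ L i * N i (x i - y i)

/-- `g(x, ξ)`, `ξ ∼ D`, is an unbiased stochastic gradient of `f` whose `i`-th block has variance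
at most `σ_i²` in the Euclidean norm. -/
def IsStochasticGradient {Ξ : Type*} [MeasurableSpace Ξ] (D : Measure Ξ) (σ : Fin p → ℝ)
    (f : Params a b → ℝ) (g : Params a b → Ξ → Params a b) : Prop :=
  Measurable (Function.uncurry g) ∧ ∀ x,
    (Integrable (g x) D ∧ ∫ ξ, g x ξ ∂D = gradient f x) ∧
    ∀ i, Integrable (fun ξ => ‖g x ξ i - blockGrad f i x‖ ^ 2) D ∧
      ∫ ξ, ‖g x ξ i - blockGrad f i x‖ ^ 2 ∂D ≤ σ i ^ 2

/-- The constant `ζ_i`, as a function of `ρ̲_i, ρ̄_i, β_i, α_P, α_D, L_i` and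
`Lt2 = (1/n) ∑_j L_{i,j}²`. -/
noncomputable def zeta (ρlo ρhi β αP αD L Lt2 : ℝ) : ℝ :=
  ρhi ^ 2 / ρlo ^ 2 *
    (12 / β ^ 2 * L ^ 2 + 24 * (β + 2) / αP ^ 2 * L ^ 2 + 36 * (β ^ 2 + 4) / αD ^ 2 * Lt2 +
      144 * β ^ 2 * (2 * β + 5) / (αP ^ 2 * αD ^ 2) * Lt2)

end Problem

section Algorithm

variable {n p : ℕ} {a b : Fin p → ℕ}

/-- The variables of the algorithm at an iteration: the iterate `X`, the shift `W`, and the momenta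
`M_j` and gradient estimators `G_j` of the workers. -/
structure State (n : ℕ) {p : ℕ} (a b : Fin p → ℕ) where
  X : Params a b
  W : Params a b
  M : Fin n → Params a b
  G : Fin n → Params a b

/-- The average `(1/n) ∑_j V_j` over the workers. -/
noncomputable def workerAvg (V : Fin n → Params a b) : Params a b := (n : ℝ)⁻¹ • ∑ j, V j

/-- `X_i⁺ = X_i - γ_i (G_i)^♯` with `G = (1/n) ∑_j G_j`. -/
noncomputable def nextX (sharp : ∀ i, Layer (a i) (b i) → Layer (a i) (b i)) (γ : Fin p → ℝ)
    (s : State n a b) : Params a b :=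
  WithLp.toLp 2 fun i => s.X i - γ i • sharp i (workerAvg s.G i)

/-- `W_i⁺ = W_i + C_i(X_i⁺ - W_i)`. -/
noncomputable def nextW (C : ∀ i, Layer (a i) (b i) → Layer (a i) (b i)) (X W : Params a b) :
    Params a b :=
  WithLp.toLp 2 fun i => W i + C i (X i - W i)

/-- `M_{i,j}⁺ = (1 - β_i) M_{i,j} + β_i ∇_i f_j(W⁺; ξ_j)`; here `v` is the stochastic gradient. -/
noncomputable def nextM (β : Fin p → ℝ) (M v : Params a b) : Params a b :=
  WithLp.toLp 2 fun i => (1 - β i) • M i + β i • v i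

/-- `G_{i,j}⁺ = G_{i,j} + C_{i,j}(M_{i,j}⁺ - G_{i,j})`. -/
noncomputable def nextG (C : ∀ i, Layer (a i) (b i) → Layer (a i) (b i)) (M G : Params a b) :
    Params a b :=
  WithLp.toLp 2 fun i => G i + C i (M i - G i)

/-- One iteration of EF21-Muon, with the server compressors `CP i`, the worker compressors
`CD i j` and the stochastic gradients `g j` that are realized in this iteration. -/
noncomputable def step (sharp : ∀ i, Layer (a i) (b i) → Layer (a i) (b i)) (γ β : Fin p → ℝ)
    (CP : ∀ i, Layer (a i) (b i) → Layer (a i) (b i))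
    (CD : ∀ i, Fin n → Layer (a i) (b i) → Layer (a i) (b i))
    (g : Fin n → Params a b → Params a b) (s : State n a b) : State n a b where
  X := nextX sharp γ s
  W := nextW CP (nextX sharp γ s) s.W
  M := fun j => nextM β (s.M j) (g j (nextW CP (nextX sharp γ s) s.W))
  G := fun j => nextG (fun i => CD i j)
    (nextM β (s.M j) (g j (nextW CP (nextX sharp γ s) s.W))) (s.G j)

/-- The iterates of EF21-Muon started at `X⁰ = W⁰`, `M_j⁰`, `G_j⁰`. In iteration `k` the server
compressors use the seed `θP k`, the worker compressors the seed `θD k` and worker `j` the sample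
`ξ (k + 1) j`. A seed is shared by all the compressors of its kind, so these may be dependent
or independent of each other. -/
noncomputable def iterate {Ω ΘP ΘD : Type*} {Ξ : Fin n → Type*}
    (sharp : ∀ i, Layer (a i) (b i) → Layer (a i) (b i)) (γ β : Fin p → ℝ)
    (CP : ℕ → ∀ i, Layer (a i) (b i) → ΘP → Layer (a i) (b i))
    (CD : ℕ → ∀ i, Fin n → Layer (a i) (b i) → ΘD → Layer (a i) (b i))
    (g : ∀ j, Params a b → Ξ j → Params a b)
    (X₀ : Params a b) (M₀ G₀ : Ω → Fin n → Params a b)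
    (θP : ℕ → Ω → ΘP) (θD : ℕ → Ω → ΘD) (ξ : ℕ → ∀ j, Ω → Ξ j) : ℕ → Ω → State n a b
  | 0, ω => ⟨X₀, X₀, M₀ ω, G₀ ω⟩
  | k + 1, ω =>
      step sharp γ β (fun i x => CP k i x (θP k ω)) (fun i j x => CD k i j x (θD k ω))
        (fun j x => g j x (ξ (k + 1) j ω))
        (iterate sharp γ β CP CD g X₀ M₀ G₀ θP θD ξ k ω)

/-- The sources of randomness: the initialization, and in each iteration `k` the server
compressors, the sample of each worker, and the worker compressors. -/
inductive Source (n : ℕ) where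
  | init : Source n
  | server (k : ℕ) : Source n
  | sample (k : ℕ) (j : Fin n) : Source n
  | worker (k : ℕ) : Source n

/-- The σ-algebra generated by a source of randomness. -/
@[reducible] def sourceAlgebra {Ω ΘP ΘD : Type*} {Ξ : Fin n → Type*} [MeasurableSpace ΘP] [MeasurableSpace ΘD]
    [∀ j, MeasurableSpace (Ξ j)] (M₀ G₀ : Ω → Fin n → Params a b)
    (θP : ℕ → Ω → ΘP) (θD : ℕ → Ω → ΘD) (ξ : ℕ → ∀ j, Ω → Ξ j) : Source n → MeasurableSpace Ω
  | .init => MeasurableSpace.comap (fun ω => (M₀ ω, G₀ ω)) inferInstance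
  | .server k => MeasurableSpace.comap (θP k) inferInstance
  | .sample k j => MeasurableSpace.comap (ξ (k + 1) j) inferInstance
  | .worker k => MeasurableSpace.comap (θD k) inferInstance

/-- The initial Lyapunov value `Ψ⁰`. -/
noncomputable def lyapunovInit {Ω : Type*} [MeasurableSpace Ω] (P : Measure Ω)
    (f : Fin n → Params a b → ℝ) (fstar : ℝ) (ρhi β γ : Fin p → ℝ) (αD : ℝ) (X₀ : Params a b)
    (M₀ G₀ : Ω → Fin n → Params a b) : ℝ :=
  avgLoss f X₀ - fstar
    + ∑ i, 6 * ρhi i ^ 2 / β i * γ i *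
        ∫ ω, ‖blockGrad (avgLoss f) i X₀ - workerAvg (M₀ ω) i‖ ^ 2 ∂P
    + ∑ i, 72 * ρhi i ^ 2 * β i / αD ^ 2 * γ i *
        ((n : ℝ)⁻¹ * ∑ j, ∫ ω, ‖blockGrad (f j) i X₀ - M₀ ω j i‖ ^ 2 ∂P)
    + ∑ i, 6 * ρhi i ^ 2 / αD * γ i *
        ((n : ℝ)⁻¹ * ∑ j, ∫ ω, ‖M₀ ω j i - G₀ ω j i‖ ^ 2 ∂P)

end Algorithm

end EFMuon

/-! The proof is a Lyapunov argument. A step along the sharp operator lowers `f` by γ_i/4 times the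
squared dual norm of the true gradient block and by a multiple of the squared step length, up to the
squared error of `G` as an estimate of that block (`Setting.descent`). This error splits into A, the
average momentum against the gradient, and C, the worker momenta against their compressed
estimators.

Both errors contract up to perturbations: A with factor 1 - β/2, since momentum is a convex
combination, and C with factor 1 - αD/2, by compression. C is fed by the individual momentum errors
B, which contract like A. All three are fed by the step length and by the shift error d between `X`
and `W`, which itself contracts with factor 1 - αP/2 (`Setting.average_step`, `Setting.worker_step`,
`IsContractiveCompressor.memLp_add`). The Lyapunov function adds weighted A, B, C and d to `f -
fstar`, with weights for which every contraction gain pays exactly for the places where that error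
is spent (`lyapunov_layer`). What remains is a multiple of the squared step length, nonpositive by
the step size condition, and the noise. Telescoping gives the rate.

The gradient noise is centered given the past, hence orthogonal to everything computed before it. It
is therefore split off before any convexity or Young inequality and keeps small coefficients; across
workers it is pairwise orthogonal, whence the term 1/n. Independence is used through product laws
and Fubini instead of conditional expectations, and square integrability is propagated along with
the estimates. -/

namespace EFMuon

/-! ### Dual norms and sharp operators. -/

section DualNorm

variable {E : Type*} [NormedAddCommGroup E] [InnerProductSpace ℝ E]
  {N : Seminorm ℝ E} {r R : ℝ}

theorem inner_le_of_le_one (hR : 0 ≤ R) (h : ∀ x, ‖x‖ ≤ R * N x) (x : E) {z : E}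
    (hz : N z ≤ 1) : inner ℝ x z ≤ R * ‖x‖ := by
  calc inner ℝ x z ≤ ‖x‖ * ‖z‖ := real_inner_le_norm x z
    _ ≤ ‖x‖ * (R * 1) := by
      gcongr
      exact (h z).trans (by gcongr)
    _ = R * ‖x‖ := by ring

theorem bddAbove_dualNorm (hR : 0 ≤ R) (h : ∀ x, ‖x‖ ≤ R * N x) (x : E) :
    BddAbove ((fun z => inner ℝ x z) '' {z | N z ≤ 1}) := by
  refine ⟨R * ‖x‖, ?_⟩
  rintro _ ⟨z, hz, rfl⟩
  exact inner_le_of_le_one hR h x hz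

theorem nonempty_dualNorm (x : E) :
    ((fun z => inner ℝ x z) '' {z | N z ≤ 1}).Nonempty :=
  ⟨_, 0, by simp, rfl⟩

theorem inner_le_dualNorm (hR : 0 ≤ R) (h : ∀ x, ‖x‖ ≤ R * N x) (x : E) {z : E}
    (hz : N z ≤ 1) : inner ℝ x z ≤ dualNorm N x :=
  le_csSup (bddAbove_dualNorm hR h x) ⟨z, hz, rfl⟩

theorem dualNorm_le {x : E} {B : ℝ} (h : ∀ z, N z ≤ 1 → inner ℝ x z ≤ B) : dualNorm N x ≤ B := by
  refine csSup_le (nonempty_dualNorm x) ?_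
  rintro _ ⟨z, hz, rfl⟩
  exact h z hz

theorem dualNorm_nonneg (hR : 0 ≤ R) (h : ∀ x, ‖x‖ ≤ R * N x) (x : E) : 0 ≤ dualNorm N x := by
  simpa using inner_le_dualNorm hR h x (z := 0) (by simp)

theorem dualNorm_le_mul_norm (hR : 0 ≤ R) (h : ∀ x, ‖x‖ ≤ R * N x) (x : E) :
    dualNorm N x ≤ R * ‖x‖ :=
  dualNorm_le fun _ hz => inner_le_of_le_one hR h x hz

/-- Rescale `z` to the unit ball of `N`. If `N z = 0`, the comparison with the Euclidean norm forces
`z = 0`, so the seminorm is a norm. -/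
theorem inner_le_dualNorm_mul (hR : 0 ≤ R) (h : ∀ x, ‖x‖ ≤ R * N x) (x z : E) :
    inner ℝ x z ≤ dualNorm N x * N z := by
  rcases (apply_nonneg N z).eq_or_lt with h0 | h0
  · have hz : z = 0 := by
      have := h z
      rw [← h0, mul_zero] at this
      exact norm_le_zero_iff.1 this
    simp [hz]
  · have := inner_le_dualNorm hR h x (z := (N z)⁻¹ • z) (by
      rw [map_smul_eq_mul, Real.norm_of_nonneg (by positivity), inv_mul_cancel₀ h0.ne'])
    rw [inner_smul_right] at this
    calc inner ℝ x z = (N z)⁻¹ * inner ℝ x z * N z := by field_simp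
      _ ≤ _ := by gcongr

/-- Pair `x` with itself. This turns smoothness in the dual norm into Euclidean bounds, which is how
the lower equivalence constant enters. -/
theorem mul_norm_le_dualNorm (hr : 0 < r) (hR : 0 ≤ R) (h : ∀ x, ‖x‖ ≤ R * N x)
    (h' : ∀ x, r * N x ≤ ‖x‖) (x : E) : r * ‖x‖ ≤ dualNorm N x := by
  rcases eq_or_ne x 0 with rfl | hx
  · simpa using dualNorm_nonneg hR h (0 : E)
  have hx' : 0 < ‖x‖ := norm_pos_iff.2 hx
  have h1 := inner_le_dualNorm_mul hR h x x
  rw [real_inner_self_eq_norm_sq] at h1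
  have h2 : r * ‖x‖ ^ 2 ≤ dualNorm N x * ‖x‖ :=
    calc r * ‖x‖ ^ 2 ≤ r * (dualNorm N x * N x) := by gcongr
      _ = dualNorm N x * (r * N x) := by ring
      _ ≤ _ := mul_le_mul_of_nonneg_left (h' x) (dualNorm_nonneg hR h x)
  refine le_of_mul_le_mul_right ?_ hx'
  linarith [h2, sq ‖x‖]

theorem dualNorm_add_le (hR : 0 ≤ R) (h : ∀ x, ‖x‖ ≤ R * N x) (x y : E) :
    dualNorm N (x + y) ≤ dualNorm N x + dualNorm N y :=
  dualNorm_le fun z hz => by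
    rw [inner_add_left]
    exact add_le_add (inner_le_dualNorm hR h x hz) (inner_le_dualNorm hR h y hz)

theorem continuous_dualNorm (hR : 0 ≤ R) (h : ∀ x, ‖x‖ ≤ R * N x) :
    Continuous (dualNorm N : E → ℝ) := by
  refine LipschitzWith.continuous (K := ⟨R, hR⟩) (LipschitzWith.of_le_add_mul _ fun x y => ?_)
  have h1 := dualNorm_add_le hR h y (x - y)
  rw [add_sub_cancel] at h1
  rw [dist_eq_norm]
  exact h1.trans (by gcongr; exact dualNorm_le_mul_norm hR h _)

/-- First-order optimality along the ray through `s x`: the function t ↦ tA - t²B/2 is maximal at t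
= 1, so A = B. -/
theorem IsSharpOperator.inner_eq {s : E → E} (hs : IsSharpOperator N s) (x : E) :
    inner ℝ x (s x) = N (s x) ^ 2 := by
  have key : ∀ t : ℝ, t * inner ℝ x (s x) - t ^ 2 * N (s x) ^ 2 / 2
      ≤ inner ℝ x (s x) - N (s x) ^ 2 / 2 := fun t => by
    have := hs x (Set.mem_univ (t • s x))
    simpa [inner_smul_right, map_smul_eq_mul, mul_pow] using this
  set A := inner ℝ x (s x)
  set B := N (s x) ^ 2
  have hB : 0 ≤ B := by positivity
  have h0 := key 0
  have h1 : (A - B) ^ 2 ≤ 0 := by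
    -- The optimal perturbation of t = 1 would be (A - B)/B; the denominator B + 1 also covers B =
    -- 0.
    have h2 := key (1 + (A - B) / (B + 1))
    have h3 : (A - B) ^ 2 / (B + 1) - ((A - B) / (B + 1)) ^ 2 * B / 2 ≤ 0 := by
      have e : (A - B) ^ 2 / (B + 1) = (A - B) / (B + 1) * (A - B) := by ring
      rw [e]
      nlinarith
    have h4 : (A - B) ^ 2 * (B + 2) / (2 * (B + 1) ^ 2) ≤ 0 := by
      refine le_of_eq_of_le ?_ h3
      field_simp
      ring
    by_contra hc
    have : 0 < (A - B) ^ 2 * (B + 2) / (2 * (B + 1) ^ 2) := by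
      have : 0 < (A - B) ^ 2 := not_le.1 hc
      positivity
    linarith
  nlinarith [sq_nonneg (A - B), pow_eq_zero_iff (two_ne_zero) |>.1 (le_antisymm h1 (sq_nonneg _))]

theorem IsSharpOperator.apply_eq_dualNorm (hR : 0 ≤ R) (h : ∀ x, ‖x‖ ≤ R * N x) {s : E → E}
    (hs : IsSharpOperator N s) (x : E) : N (s x) = dualNorm N x := by
  have h1 := hs.inner_eq x
  apply le_antisymm
  · rcases (apply_nonneg N (s x)).eq_or_lt with h0 | h0
    · rw [← h0]
      exact dualNorm_nonneg hR h x
    · have := inner_le_dualNorm_mul hR h x (s x)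
      rw [h1, sq] at this
      exact le_of_mul_le_mul_right this h0
  · refine dualNorm_le fun z hz => ?_
    rcases le_or_gt (inner ℝ x z) 0 with h0 | h0
    · exact h0.trans (apply_nonneg _ _)
    -- At this competitor the objective is at least ⟨x, z⟩²/2 because `N z ≤ 1`, while its maximum
    -- is `N (s x) ^ 2 / 2`.
    have h2 := hs x (Set.mem_univ ((inner ℝ x z : ℝ) • z))
    simp only [inner_smul_right, map_smul_eq_mul, Set.mem_ofPred_eq, h1,
      Real.norm_of_nonneg h0.le] at h2
    have h3 : (inner ℝ x z : ℝ) * N z ≤ inner ℝ x z * 1 := by gcongr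
    have h4 : ((inner ℝ x z : ℝ) * N z) ^ 2 ≤ (inner ℝ x z * 1) ^ 2 := by gcongr
    refine le_of_sq_le_sq ?_ (apply_nonneg _ _)
    nlinarith

/-- One layer of the descent estimate for a sharp-operator step. -/
theorem IsSharpOperator.descent (hR : 0 ≤ R) (h : ∀ x, ‖x‖ ≤ R * N x) {s : E → E}
    (hs : IsSharpOperator N s) (d x : E) :
    -inner ℝ d (s x) ≤ -(1 / 4) * dualNorm N d ^ 2 - 1 / 4 * N (s x) ^ 2
      + 3 / 2 * (R ^ 2 * ‖d - x‖ ^ 2) := by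
  have h1 := hs.inner_eq x
  have h2 := hs.apply_eq_dualNorm hR h x
  have h3 := inner_le_dualNorm_mul hR h (x - d) (s x)
  rw [inner_sub_left, h1] at h3
  have h4 := dualNorm_add_le hR h x (d - x)
  rw [add_sub_cancel, ← h2] at h4
  have h5 := dualNorm_le_mul_norm hR h (d - x)
  have h6 := dualNorm_le_mul_norm hR h (x - d)
  rw [norm_sub_rev] at h6
  have h7 := dualNorm_nonneg hR h d
  have h8 : 0 ≤ N (s x) := apply_nonneg _ _
  set e := R * ‖d - x‖
  have he : R ^ 2 * ‖d - x‖ ^ 2 = e ^ 2 := by ring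
  rw [he]
  have h9 : dualNorm N (x - d) * N (s x) ≤ e * N (s x) := by gcongr
  have h10 : dualNorm N d ^ 2 ≤ (N (s x) + e) ^ 2 := by gcongr; linarith
  -- With ν = `N (s x)`, the slack between -ν² + eν and -(ν + e)²/4 - ν²/4 + 3e²/2 is exactly ((ν -
  -- 2e)² + (ν - e)²)/4.
  nlinarith [sq_nonneg (N (s x) - 2 * e), sq_nonneg (N (s x) - e)]

theorem IsSharpOperator.norm_le (hR : 0 ≤ R) (h : ∀ x, ‖x‖ ≤ R * N x) {s : E → E}
    (hs : IsSharpOperator N s) (x : E) : ‖s x‖ ≤ R ^ 2 * ‖x‖ := by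
  calc ‖s x‖ ≤ R * N (s x) := h _
    _ = R * dualNorm N x := by rw [hs.apply_eq_dualNorm hR h]
    _ ≤ R * (R * ‖x‖) := by gcongr; exact dualNorm_le_mul_norm hR h x
    _ = R ^ 2 * ‖x‖ := by ring

end DualNorm

/-! ### Consequences of layer-wise smoothness. -/

section Smooth

variable {n p : ℕ} {a b : Fin p → ℕ}

theorem inner_gradient_eq_sum (f : Params a b → ℝ) (x h : Params a b) :
    inner ℝ (gradient f x) h = ∑ i, inner ℝ (blockGrad f i x) (h i) := by
  rw [PiLp.inner_apply]
  rfl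

/-- The descent lemma of a layer-wise smooth function. -/
theorem LayerwiseSmooth.le_add {N : ∀ i, Seminorm ℝ (Layer (a i) (b i))} {R L : Fin p → ℝ}
    (hR : ∀ i, 0 ≤ R i) (h : ∀ i x, ‖x‖ ≤ R i * N i x) {f : Params a b → ℝ}
    (hf : LayerwiseSmooth N L f) (x d : Params a b) :
    f (x + d) ≤ f x + ∑ i, (inner ℝ (blockGrad f i x) (d i) + L i / 2 * N i (d i) ^ 2) := by
  have hder : ∀ t : ℝ, HasDerivAt (fun t : ℝ => f (x + t • d))
      (∑ i, inner ℝ (blockGrad f i (x + t • d)) (d i)) t := fun t => by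
    have h1 : HasDerivAt (fun t : ℝ => x + t • d) d t := by
      simpa using ((hasDerivAt_id t).smul_const d).const_add x
    have h2 := ((hf.1 (x + t • d)).hasGradientAt.hasFDerivAt).comp_hasDerivAt t h1
    rw [← inner_gradient_eq_sum]
    exact h2
  -- The gap between `f` on the segment and its quadratic model; smoothness makes its derivative
  -- nonpositive, and the claim is q(1) ≤ q(0).
  let q : ℝ → ℝ := fun t => f (x + t • d) - (t * ∑ i, inner ℝ (blockGrad f i x) (d i)
    + t ^ 2 * ∑ i, L i / 2 * N i (d i) ^ 2)
  have hq : ∀ t, HasDerivAt q ((∑ i, inner ℝ (blockGrad f i (x + t • d)) (d i)) -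
      (1 * ∑ i, inner ℝ (blockGrad f i x) (d i)
        + (2 * t) * ∑ i, L i / 2 * N i (d i) ^ 2)) t := fun t => by
    refine (hder t).sub (((hasDerivAt_id t).mul_const _).add (HasDerivAt.mul_const ?_ _))
    simpa using hasDerivAt_pow 2 t
  have hanti : AntitoneOn q (Set.Icc 0 1) := by
    refine antitoneOn_of_deriv_nonpos (convex_Icc 0 1)
      (fun t _ => (hq t).continuousAt.continuousWithinAt)
      (fun t _ => (hq t).differentiableAt.differentiableWithinAt) fun t ht => ?_
    rw [interior_Icc] at ht
    rw [(hq t).deriv, one_mul, Finset.mul_sum, ← Finset.sum_add_distrib, ← Finset.sum_sub_distrib]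
    refine Finset.sum_nonpos fun i _ => ?_
    have h3 := inner_le_dualNorm_mul (hR i) (h i)
      (blockGrad f i (x + t • d) - blockGrad f i x) (d i)
    have h4 := (hf.2 i).2 (x + t • d) x
    have h5 : (x + t • d) i - x i = t • d i := by simp
    rw [h5, map_smul_eq_mul, Real.norm_of_nonneg ht.1.le] at h4
    have h6 := mul_le_mul_of_nonneg_right h4 (apply_nonneg (N i) (d i))
    rw [inner_sub_left] at h3
    nlinarith
  have h01 := hanti (Set.left_mem_Icc.2 zero_le_one) (Set.right_mem_Icc.2 zero_le_one) zero_le_one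
  simp only [q, one_smul, zero_smul, add_zero, zero_mul, one_mul, one_pow, ne_eq,
    OfNat.ofNat_ne_zero, not_false_eq_true, zero_pow, sub_zero] at h01
  rw [Finset.sum_add_distrib]
  linarith

theorem LayerwiseSmooth.norm_sub_le {N : ∀ i, Seminorm ℝ (Layer (a i) (b i))} {r R L : Fin p → ℝ}
    (hr : ∀ i, 0 < r i) (hR : ∀ i, 0 ≤ R i) (h' : ∀ i x, r i * N i x ≤ ‖x‖)
    (h : ∀ i x, ‖x‖ ≤ R i * N i x) {f : Params a b → ℝ}
    (hf : LayerwiseSmooth N L f) (i : Fin p) (x y : Params a b) :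
    ‖blockGrad f i x - blockGrad f i y‖ ^ 2 ≤ L i ^ 2 / r i ^ 2 * N i (x i - y i) ^ 2 := by
  have h1 := (mul_norm_le_dualNorm (hr i) (hR i) (h i) (h' i) _).trans ((hf.2 i).2 x y)
  have h2 : ‖blockGrad f i x - blockGrad f i y‖ ≤ L i / r i * N i (x i - y i) := by
    rw [div_mul_eq_mul_div, le_div_iff₀' (hr i)]
    exact h1
  calc _ ≤ (L i / r i * N i (x i - y i)) ^ 2 := by gcongr
    _ = _ := by rw [mul_pow, div_pow]

theorem LayerwiseSmooth.continuous_blockGrad {N : ∀ i, Seminorm ℝ (Layer (a i) (b i))}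
    {r R L : Fin p → ℝ} (hr : ∀ i, 0 < r i) (hR : ∀ i, 0 ≤ R i)
    (h' : ∀ i x, r i * N i x ≤ ‖x‖) (h : ∀ i x, ‖x‖ ≤ R i * N i x) {f : Params a b → ℝ}
    (hf : LayerwiseSmooth N L f) (i : Fin p) : Continuous (blockGrad f i) := by
  refine LipschitzWith.continuous (K := ⟨L i / r i ^ 2, by have := (hf.2 i).1; positivity⟩)
    (LipschitzWith.of_dist_le_mul fun x y => ?_)
  rw [dist_eq_norm, dist_eq_norm]
  change _ ≤ L i / r i ^ 2 * ‖x - y‖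
  have h1 := (mul_norm_le_dualNorm (hr i) (hR i) (h i) (h' i) _).trans ((hf.2 i).2 x y)
  have h2 : r i * N i (x i - y i) ≤ ‖x - y‖ := (h' i _).trans (PiLp.norm_apply_le (x - y) i)
  have hL := (hf.2 i).1
  have h3 : L i * (r i * N i (x i - y i)) ≤ L i * ‖x - y‖ := by gcongr
  have hri := hr i
  rw [div_mul_eq_mul_div, le_div_iff₀ (by positivity)]
  nlinarith

theorem blockGrad_avgLoss {f : Fin n → Params a b → ℝ} (hf : ∀ j, Differentiable ℝ (f j))
    (i : Fin p) (x : Params a b) :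
    blockGrad (avgLoss f) i x = (n : ℝ)⁻¹ • ∑ j, blockGrad (f j) i x := by
  have h : HasGradientAt (avgLoss f) ((n : ℝ)⁻¹ • ∑ j, gradient (f j) x) x := by
    rw [hasGradientAt_iff_hasFDerivAt]
    have := (HasFDerivAt.fun_sum fun j (_ : j ∈ Finset.univ) =>
      ((hf j x).hasGradientAt.hasFDerivAt)).const_mul (n : ℝ)⁻¹
    have e : InnerProductSpace.toDual ℝ (Params a b) ((n : ℝ)⁻¹ • ∑ j, gradient (f j) x)
        = (n : ℝ)⁻¹ • ∑ j, InnerProductSpace.toDual ℝ (Params a b) (gradient (f j) x) := by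
      simp
    rw [e]
    exact this
  unfold blockGrad
  rw [h.gradient]
  simp

theorem workerAvg_apply (V : Fin n → Params a b) (i : Fin p) :
    workerAvg V i = (n : ℝ)⁻¹ • ∑ j, V j i := by
  simp [workerAvg]

end Smooth

theorem norm_avg_sq_le {n : ℕ} {E : Type*} [NormedAddCommGroup E] [NormedSpace ℝ E]
    (v : Fin n → E) : ‖(n : ℝ)⁻¹ • ∑ j, v j‖ ^ 2 ≤ (n : ℝ)⁻¹ * ∑ j, ‖v j‖ ^ 2 := by
  rcases Nat.eq_zero_or_pos n with rfl | hn
  · simp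
  have h1 : ‖∑ j, v j‖ ^ 2 ≤ n * ∑ j, ‖v j‖ ^ 2 := by
    calc ‖∑ j, v j‖ ^ 2 ≤ (∑ j, ‖v j‖) ^ 2 := by gcongr; exact norm_sum_le _ _
      _ ≤ _ := by simpa using sq_sum_le_card_mul_sum_sq (s := Finset.univ) (f := fun j => ‖v j‖)
  rw [norm_smul, mul_pow, norm_inv, Real.norm_natCast]
  calc _ ≤ ((n : ℝ)⁻¹) ^ 2 * (n * ∑ j, ‖v j‖ ^ 2) := by gcongr
    _ = _ := by
      have : (n : ℝ) ≠ 0 := by positivity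
      field_simp

/-! ### Pointwise Young and convexity inequalities. -/

section Young

variable {E : Type*} [NormedAddCommGroup E]

/-- Half of the contraction 1 - α is given up to absorb the drift `y`. The difference of the two
sides is written as an explicit sum of squares, so α = 1 needs no separate case. -/
theorem add_sq_le_young {α x y : ℝ} (h0 : 0 < α) (h1 : α ≤ 1) :
    (1 - α) * (x + y) ^ 2 ≤ (1 - α / 2) * x ^ 2 + 2 / α * y ^ 2 := by
  have e : (1 - α / 2) * x ^ 2 + 2 / α * y ^ 2 - (1 - α) * (x + y) ^ 2
      = ((α * x - 2 * (1 - α) * y) ^ 2 + 2 * α * (3 - α) * y ^ 2) / (2 * α) := by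
    field_simp
    ring
  have : 0 ≤ 3 - α := by linarith
  have : 0 ≤ ((α * x - 2 * (1 - α) * y) ^ 2 + 2 * α * (3 - α) * y ^ 2) / (2 * α) := by positivity
  linarith

theorem norm_add_sq_le_young {α : ℝ} (h0 : 0 < α) (h1 : α ≤ 1) (x y : E) :
    (1 - α) * ‖x + y‖ ^ 2 ≤ (1 - α / 2) * ‖x‖ ^ 2 + 2 / α * ‖y‖ ^ 2 := by
  refine le_trans ?_ (add_sq_le_young h0 h1)
  have : 0 ≤ 1 - α := by linarith
  gcongr
  exact norm_add_le _ _

theorem norm_add_three_sq_le (x y z : E) :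
    ‖x + y + z‖ ^ 2 ≤ 3 * (‖x‖ ^ 2 + ‖y‖ ^ 2 + ‖z‖ ^ 2) := by
  have : ‖x + y + z‖ ≤ ‖x‖ + ‖y‖ + ‖z‖ := norm_add₃_le
  calc _ ≤ (‖x‖ + ‖y‖ + ‖z‖) ^ 2 := by gcongr
    _ ≤ _ := by nlinarith [sq_nonneg (‖x‖ - ‖y‖), sq_nonneg (‖x‖ - ‖z‖), sq_nonneg (‖y‖ - ‖z‖)]

variable [NormedSpace ℝ E]

theorem norm_convex_sq_le {β : ℝ} (h0 : 0 ≤ β) (h1 : β ≤ 1) (x y : E) :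
    ‖(1 - β) • x + β • y‖ ^ 2 ≤ (1 - β) * ‖x‖ ^ 2 + β * ‖y‖ ^ 2 := by
  have h2 : 0 ≤ 1 - β := by linarith
  have h3 : ‖(1 - β) • x + β • y‖ ≤ (1 - β) * ‖x‖ + β * ‖y‖ := by
    refine (norm_add_le _ _).trans (le_of_eq ?_)
    rw [norm_smul, norm_smul, Real.norm_of_nonneg h0, Real.norm_of_nonneg h2]
  calc _ ≤ ((1 - β) * ‖x‖ + β * ‖y‖) ^ 2 := by gcongr
    _ ≤ _ := by nlinarith [mul_nonneg (mul_nonneg h0 h2) (sq_nonneg (‖x‖ - ‖y‖))]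

/-- In use `m` is the old momentum, `c` and `c'` are the gradients at the old and new iterate, and
`d` is the gradient at the shift. The new error is a convex combination of `m - c'` and `d - c'`;
Young then replaces `c'` by `c` in the first. -/
theorem norm_momentum_sq_le {β : ℝ} (h0 : 0 < β) (h1 : β ≤ 1) (m c c' d : E) :
    ‖(1 - β) • m + β • d - c'‖ ^ 2
      ≤ (1 - β / 2) * ‖c - m‖ ^ 2 + 2 / β * ‖c' - c‖ ^ 2 + β * ‖d - c'‖ ^ 2 := by
  have e : (1 - β) • m + β • d - c' = (1 - β) • (m - c') + β • (d - c') := by module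
  have h2 := norm_add_sq_le_young h0 h1 (c - m) (c' - c)
  have e2 : c - m + (c' - c) = -(m - c') := by abel
  rw [e2, norm_neg] at h2
  rw [e]
  linarith [norm_convex_sq_le h0.le h1 (m - c') (d - c')]

/-- Here `v` is the old estimator. The momentum moves by β(d - m), and d - m is split through `c'`
and `c` so that only controlled errors appear; 6 is the Young factor 2 times 3 for three summands.
-/
theorem norm_estimator_sq_le {α : ℝ} (h0 : 0 < α) (h1 : α ≤ 1) (β : ℝ) (m v c c' d : E) :
    (1 - α) * ‖(1 - β) • m + β • d - v‖ ^ 2 ≤ (1 - α / 2) * ‖m - v‖ ^ 2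
      + 6 * β ^ 2 / α * (‖d - c'‖ ^ 2 + ‖c' - c‖ ^ 2 + ‖c - m‖ ^ 2) := by
  have e : (1 - β) • m + β • d - v = (m - v) + β • ((d - c') + (c' - c) + (c - m)) := by module
  rw [e]
  refine (norm_add_sq_le_young h0 h1 _ _).trans ?_
  rw [norm_smul, mul_pow, Real.norm_eq_abs, sq_abs]
  have h2 := norm_add_three_sq_le (d - c') (c' - c) (c - m)
  have h3 := mul_le_mul_of_nonneg_left h2 (show 0 ≤ 2 / α * β ^ 2 by positivity)
  have e2 : 6 * β ^ 2 / α = 2 / α * β ^ 2 * 3 := by ring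
  rw [e2]
  linarith

end Young

/-! ### Orthogonality in L². -/

section Orthogonal

variable {Ω E : Type*} [MeasurableSpace Ω] {P : Measure Ω}
  [NormedAddCommGroup E] [InnerProductSpace ℝ E]

theorem integrable_inner_of_sq {u v : Ω → E} (hu : MemLp u 2 P) (hv : MemLp v 2 P) :
    Integrable (fun ω => inner ℝ (u ω) (v ω)) P := by
  have h1 := (hu.integrable_norm_pow two_ne_zero).add (hv.integrable_norm_pow two_ne_zero)
  refine h1.mono' (hu.aestronglyMeasurable.inner hv.aestronglyMeasurable)
    (Filter.Eventually.of_forall fun ω => ?_)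
  have h2 := abs_real_inner_le_norm (u ω) (v ω)
  rw [Real.norm_eq_abs]
  simp only [Pi.add_apply]
  nlinarith [sq_nonneg (‖u ω‖ - ‖v ω‖), sq_nonneg (‖u ω‖), sq_nonneg (‖v ω‖)]

theorem integral_norm_add_sq_of_orthogonal {u v : Ω → E} (hu : MemLp u 2 P) (hv : MemLp v 2 P)
    (h : ∫ ω, inner ℝ (u ω) (v ω) ∂P = 0) :
    ∫ ω, ‖u ω + v ω‖ ^ 2 ∂P = ∫ ω, ‖u ω‖ ^ 2 ∂P + ∫ ω, ‖v ω‖ ^ 2 ∂P := by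
  have h1 := hu.integrable_norm_pow two_ne_zero
  have h2 := hv.integrable_norm_pow two_ne_zero
  have h3 := (integrable_inner_of_sq hu hv).const_mul 2
  simp_rw [norm_add_sq_real]
  rw [integral_add (by exact h1.add h3) h2, integral_add h1 h3, integral_const_mul, h]
  ring

/-- Only the diagonal of the double sum survives. This is the source of the variance reduction by
1/n. -/
theorem integral_norm_avg_sq_of_orthogonal {n : ℕ} {e : Fin n → Ω → E}
    (he : ∀ j, MemLp (e j) 2 P) (h : ∀ j l, l ≠ j → ∫ ω, inner ℝ (e l ω) (e j ω) ∂P = 0) :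
    ∫ ω, ‖(n : ℝ)⁻¹ • ∑ j, e j ω‖ ^ 2 ∂P = ((n : ℝ)⁻¹) ^ 2 * ∑ j, ∫ ω, ‖e j ω‖ ^ 2 ∂P := by
  have h1 : ∀ ω, ‖(n : ℝ)⁻¹ • ∑ j, e j ω‖ ^ 2
      = ((n : ℝ)⁻¹) ^ 2 * ∑ j, ∑ l, inner ℝ (e l ω) (e j ω) := fun ω => by
    rw [norm_smul, mul_pow, Real.norm_eq_abs, sq_abs, ← real_inner_self_eq_norm_sq, inner_sum]
    simp_rw [sum_inner]
  simp_rw [h1]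
  rw [integral_const_mul, integral_finsetSum _ fun j _ =>
    integrable_finsetSum _ fun l _ => integrable_inner_of_sq (he l) (he j)]
  congr 1
  refine Finset.sum_congr rfl fun j _ => ?_
  rw [integral_finsetSum _ fun l _ => integrable_inner_of_sq (he l) (he j),
    Finset.sum_eq_single j (fun l _ hl => h j l hl) (by simp)]
  simp_rw [real_inner_self_eq_norm_sq]

end Orthogonal

/-! ### Integration against an independent seed. -/

section Probability

variable {Ω Θ F E : Type*} [MeasurableSpace Ω] [MeasurableSpace Θ] [MeasurableSpace F]
  {P : Measure Ω} [IsProbabilityMeasure P]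

/-- Independence makes the joint law a product, so Fubini plays the role of conditioning on `Y`.
Integrability is part of the conclusion: the inner integrals are dominated by the integrable `φ`. -/
theorem IndepFun.integrable_comp_of_nonneg {Y : Ω → F} {θ : Ω → Θ} (hY : Measurable Y)
    (hθ : Measurable θ) (hind : IndepFun Y θ P) {h : F × Θ → ℝ} (hh : Measurable h)
    (h0 : ∀ z, 0 ≤ h z) {φ : F → ℝ}
    (hint : ∀ y, Integrable (fun t => h (y, t)) (P.map θ))
    (hle : ∀ y, ∫ t, h (y, t) ∂(P.map θ) ≤ φ y) (hφm : Measurable φ)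
    (hφ : Integrable (fun ω => φ (Y ω)) P) :
    Integrable (fun ω => h (Y ω, θ ω)) P ∧ ∫ ω, h (Y ω, θ ω) ∂P ≤ ∫ ω, φ (Y ω) ∂P := by
  have hmap := (indepFun_iff_map_prod_eq_prod_map_map hY.aemeasurable hθ.aemeasurable).1 hind
  have : IsProbabilityMeasure (P.map Y) := Measure.isProbabilityMeasure_map hY.aemeasurable
  have : IsProbabilityMeasure (P.map θ) := Measure.isProbabilityMeasure_map hθ.aemeasurable
  have hφ' : Integrable φ (P.map Y) :=
    (integrable_map_measure hφm.aestronglyMeasurable hY.aemeasurable).2 hφ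
  have hnn : ∀ y, 0 ≤ ∫ t, h (y, t) ∂(P.map θ) := fun y => integral_nonneg fun t => h0 _
  have hI : Integrable (fun y => ∫ t, h (y, t) ∂(P.map θ)) (P.map Y) := by
    refine hφ'.mono' (StronglyMeasurable.integral_prod_right
      (f := fun y t => h (y, t)) hh.stronglyMeasurable).aestronglyMeasurable
      (Filter.Eventually.of_forall fun y => ?_)
    rw [Real.norm_of_nonneg (hnn y)]
    exact hle y
  have hprod : Integrable h ((P.map Y).prod (P.map θ)) := by
    rw [integrable_prod_iff hh.aestronglyMeasurable]
    refine ⟨Filter.Eventually.of_forall hint, ?_⟩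
    simpa only [Real.norm_of_nonneg (h0 _)] using hI
  have hprod' := hprod
  rw [← hmap] at hprod'
  refine ⟨(integrable_map_measure hh.aestronglyMeasurable (hY.prodMk hθ).aemeasurable).1 hprod', ?_⟩
  calc ∫ ω, h (Y ω, θ ω) ∂P = ∫ z, h z ∂(P.map fun ω => (Y ω, θ ω)) :=
        (integral_map (hY.prodMk hθ).aemeasurable hh.aestronglyMeasurable).symm
    _ = ∫ y, ∫ t, h (y, t) ∂(P.map θ) ∂(P.map Y) := by
        rw [hmap, integral_prod _ hprod]
    _ ≤ ∫ y, φ y ∂(P.map Y) := integral_mono hI hφ' hle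
    _ = ∫ ω, φ (Y ω) ∂P := integral_map hY.aemeasurable hφm.aestronglyMeasurable

theorem IndepFun.integral_comp_eq_zero {Y : Ω → F} {θ : Ω → Θ} (hY : Measurable Y)
    (hθ : Measurable θ) (hind : IndepFun Y θ P) {h : F × Θ → ℝ} (hh : Measurable h)
    (hint : Integrable (fun ω => h (Y ω, θ ω)) P)
    (h0 : ∀ y, ∫ t, h (y, t) ∂(P.map θ) = 0) :
    ∫ ω, h (Y ω, θ ω) ∂P = 0 := by
  have hmap := (indepFun_iff_map_prod_eq_prod_map_map hY.aemeasurable hθ.aemeasurable).1 hind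
  have : IsProbabilityMeasure (P.map Y) := Measure.isProbabilityMeasure_map hY.aemeasurable
  have : IsProbabilityMeasure (P.map θ) := Measure.isProbabilityMeasure_map hθ.aemeasurable
  have hprod : Integrable h ((P.map Y).prod (P.map θ)) := by
    rw [← hmap]
    exact (integrable_map_measure hh.aestronglyMeasurable (hY.prodMk hθ).aemeasurable).2 hint
  calc ∫ ω, h (Y ω, θ ω) ∂P = ∫ z, h z ∂(P.map fun ω => (Y ω, θ ω)) :=
        (integral_map (hY.prodMk hθ).aemeasurable hh.aestronglyMeasurable).symm
    _ = 0 := by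
        rw [hmap, integral_prod _ hprod]
        simp [h0]

variable [NormedAddCommGroup E] [MeasurableSpace E] [BorelSpace E] [SecondCountableTopology E]

/-- Compression of a random vector which is independent of the seed of the compressor. -/
theorem IsContractiveCompressor.integral_le {θ : Ω → Θ} {N : E → ℝ} {α : ℝ} {C : E → Θ → E}
    (hC : IsContractiveCompressor (P.map θ) N α C) (hN : Measurable N) (hθ : Measurable θ)
    {Y : Ω → E} (hY : Measurable Y) (hind : IndepFun Y θ P)
    (hint : Integrable (fun ω => N (Y ω) ^ 2) P) :
    Integrable (fun ω => N (C (Y ω) (θ ω) - Y ω) ^ 2) P ∧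
      ∫ ω, N (C (Y ω) (θ ω) - Y ω) ^ 2 ∂P ≤ (1 - α) * ∫ ω, N (Y ω) ^ 2 ∂P := by
  rw [← integral_const_mul]
  refine IndepFun.integrable_comp_of_nonneg hY hθ hind
    (h := fun z => N (C z.1 z.2 - z.1) ^ 2) (φ := fun y => (1 - α) * N y ^ 2) ?_
    (fun z => sq_nonneg _) (fun y => (hC.2.2 y).1) (fun y => (hC.2.2 y).2) ?_ ?_
  · have h1 : Measurable fun z : E × Θ => C z.1 z.2 := hC.2.1
    exact (hN.comp (h1.sub measurable_fst)).pow_const 2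
  · exact (hN.pow_const 2).const_mul _
  · exact hint.const_mul _

variable [InnerProductSpace ℝ E]

/-- A centered noise `h(Y, ξ)` is orthogonal to each random vector which is, jointly with `Y`,
independent of `ξ`. -/
theorem integral_inner_noise_eq_zero [CompleteSpace E] {Y : Ω → F} {u : Ω → E} {θ : Ω → Θ}
    (hY : Measurable Y)
    (hu : Measurable u) (hθ : Measurable θ) (hind : IndepFun (fun ω => (Y ω, u ω)) θ P)
    {h : F → Θ → E} (hh : Measurable (Function.uncurry h))
    (hint : ∀ y, Integrable (h y) (P.map θ)) (h0 : ∀ y, ∫ t, h y t ∂(P.map θ) = 0)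
    (hu2 : MemLp u 2 P) (hh2 : MemLp (fun ω => h (Y ω) (θ ω)) 2 P) :
    ∫ ω, inner ℝ (u ω) (h (Y ω) (θ ω)) ∂P = 0 := by
  refine IndepFun.integral_comp_eq_zero (hY.prodMk hu) hθ hind
    (h := fun z => inner ℝ z.1.2 (h z.1.1 z.2)) ?_ (integrable_inner_of_sq hu2 hh2) fun y => ?_
  · have h1 : Measurable fun z : (F × E) × Θ => h z.1.1 z.2 :=
      hh.comp (measurable_fst.fst.prodMk measurable_snd)
    exact measurable_fst.snd.inner h1
  · change ∫ t, inner ℝ y.2 (h y.1 t) ∂(P.map θ) = 0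
    rw [integral_inner (hint y.1), h0, inner_zero_right]

end Probability

/-! ### Second moments in the layer norms. -/

section SeminormMoment

variable {Ω E : Type*} [MeasurableSpace Ω] {P : Measure Ω}
  [NormedAddCommGroup E] [NormedSpace ℝ E] {N : Seminorm ℝ E} {r R : ℝ} {Y : Ω → E}

theorem continuous_seminorm (hr : 0 < r) (h' : ∀ x, r * N x ≤ ‖x‖) : Continuous (N : E → ℝ) := by
  refine LipschitzWith.continuous (K := ⟨r⁻¹, by positivity⟩)
    (LipschitzWith.of_le_add_mul _ fun x y => ?_)
  have h1 := map_add_le_add N y (x - y)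
  rw [add_sub_cancel] at h1
  rw [dist_eq_norm]
  refine h1.trans (add_le_add le_rfl ?_)
  change N (x - y) ≤ r⁻¹ * ‖x - y‖
  rw [inv_mul_eq_div, le_div_iff₀' hr]
  exact h' _

theorem integrable_seminorm_sq (hr : 0 < r) (h' : ∀ x, r * N x ≤ ‖x‖) (hY : MemLp Y 2 P) :
    Integrable (fun ω => N (Y ω) ^ 2) P := by
  refine ((hY.integrable_norm_pow two_ne_zero).const_mul ((r ^ 2)⁻¹)).mono'
    (((continuous_seminorm hr h').comp_aestronglyMeasurable hY.aestronglyMeasurable).pow 2)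
    (Filter.Eventually.of_forall fun ω => ?_)
  rw [Real.norm_of_nonneg (by positivity), inv_mul_eq_div, le_div_iff₀' (by positivity), ← mul_pow]
  have : 0 ≤ r * N (Y ω) := mul_nonneg hr.le (apply_nonneg _ _)
  gcongr
  exact h' _

theorem memLp_of_integrable_seminorm_sq (h : ∀ x, ‖x‖ ≤ R * N x)
    (hYm : AEStronglyMeasurable Y P) (hY : Integrable (fun ω => N (Y ω) ^ 2) P) :
    MemLp Y 2 P := by
  rw [memLp_two_iff_integrable_sq_norm hYm]
  refine (hY.const_mul (R ^ 2)).mono' (hYm.norm.pow 2) (Filter.Eventually.of_forall fun ω => ?_)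
  rw [Real.norm_of_nonneg (by positivity), ← mul_pow]
  gcongr
  exact h _

/-- One server compression: `w⁺` satisfies a contraction towards `x⁺`. -/
theorem integral_shift_le (hr : 0 < r) (h' : ∀ x, r * N x ≤ ‖x‖) {α : ℝ} (h0 : 0 < α)
    (h1 : α ≤ 1) {x x' w : Ω → E} (hx : MemLp x 2 P) (hx' : MemLp x' 2 P) (hw : MemLp w 2 P) :
    (1 - α) * ∫ ω, N (x' ω - w ω) ^ 2 ∂P ≤
      (1 - α / 2) * ∫ ω, N (x ω - w ω) ^ 2 ∂P + 2 / α * ∫ ω, N (x' ω - x ω) ^ 2 ∂P := by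
  have i1 := integrable_seminorm_sq hr h' (hx'.sub hw)
  have i2 := integrable_seminorm_sq hr h' (hx.sub hw)
  have i3 := integrable_seminorm_sq hr h' (hx'.sub hx)
  simp only [Pi.sub_apply] at i1 i2 i3
  simp only [← integral_const_mul]
  rw [← integral_add (i2.const_mul _) (i3.const_mul _)]
  refine integral_mono (i1.const_mul _) ((i2.const_mul _).add (i3.const_mul _)) fun ω => ?_
  refine le_trans ?_ (add_sq_le_young h0 h1)
  have h2 : 0 ≤ 1 - α := by linarith
  have h3 : N (x' ω - w ω) ≤ N (x ω - w ω) + N (x' ω - x ω) := by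
    have := map_add_le_add N (x ω - w ω) (x' ω - x ω)
    rwa [show x ω - w ω + (x' ω - x ω) = x' ω - w ω by abel] at this
  have h4 : 0 ≤ N (x' ω - w ω) := apply_nonneg _ _
  simp only
  gcongr

end SeminormMoment

/-! ### Error recursions with noise. -/

section Recursion

variable {Ω E : Type*} [MeasurableSpace Ω] {P : Measure Ω}
  [NormedAddCommGroup E] [InnerProductSpace ℝ E] {m c c' d e v : Ω → E}

/-- The noise `e` is removed by orthogonality before convexity is applied, so it costs β² and not β.
-/
theorem integral_momentum_le {β : ℝ} (h0 : 0 < β) (h1 : β ≤ 1) (hm : MemLp m 2 P)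
    (hc : MemLp c 2 P) (hc' : MemLp c' 2 P) (hd : MemLp d 2 P) (he : MemLp e 2 P)
    (horth : ∫ ω, inner ℝ ((1 - β) • m ω + β • d ω - c' ω) (e ω) ∂P = 0) :
    ∫ ω, ‖c' ω - ((1 - β) • m ω + β • (d ω + e ω))‖ ^ 2 ∂P ≤
      (1 - β / 2) * ∫ ω, ‖c ω - m ω‖ ^ 2 ∂P + 2 / β * ∫ ω, ‖c' ω - c ω‖ ^ 2 ∂P
        + β * ∫ ω, ‖d ω - c' ω‖ ^ 2 ∂P + β ^ 2 * ∫ ω, ‖e ω‖ ^ 2 ∂P := by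
  have hu : MemLp (fun ω => (1 - β) • m ω + β • d ω - c' ω) 2 P :=
    ((hm.const_smul (1 - β)).add (hd.const_smul β)).sub hc'
  have hbe : MemLp (fun ω => β • e ω) 2 P := he.const_smul β
  have e1 : ∀ ω, ‖c' ω - ((1 - β) • m ω + β • (d ω + e ω))‖ ^ 2
      = ‖((1 - β) • m ω + β • d ω - c' ω) + β • e ω‖ ^ 2 := fun ω => by
    rw [norm_sub_rev]
    congr 2
    module
  simp_rw [e1]
  rw [integral_norm_add_sq_of_orthogonal hu hbe (by
    simp_rw [inner_smul_right]
    rw [integral_const_mul, horth, mul_zero])]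
  simp_rw [norm_smul, mul_pow, Real.norm_eq_abs, sq_abs]
  rw [integral_const_mul]
  have i1 := (hc.sub hm).integrable_norm_pow two_ne_zero
  have i2 := (hc'.sub hc).integrable_norm_pow two_ne_zero
  have i3 := (hd.sub hc').integrable_norm_pow two_ne_zero
  simp only [Pi.sub_apply] at i1 i2 i3
  gcongr
  simp only [← integral_const_mul]
  rw [← integral_add (i1.const_mul _) (i2.const_mul _),
    ← integral_add (by exact (i1.const_mul _).add (i2.const_mul _)) (i3.const_mul _)]
  exact integral_mono (hu.integrable_norm_pow two_ne_zero)
    (((i1.const_mul _).add (i2.const_mul _)).add (i3.const_mul _))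
    fun ω => norm_momentum_sq_le h0 h1 _ _ _ _

/-- Removing the noise before Young keeps its coefficient at (1 - α)β², without a factor 1/α. -/
theorem integral_estimator_le {α β : ℝ} (h0 : 0 < α) (h1 : α ≤ 1) (hm : MemLp m 2 P)
    (hc : MemLp c 2 P) (hc' : MemLp c' 2 P) (hd : MemLp d 2 P) (he : MemLp e 2 P)
    (hv : MemLp v 2 P)
    (horth : ∫ ω, inner ℝ ((1 - β) • m ω + β • d ω - v ω) (e ω) ∂P = 0) :
    (1 - α) * ∫ ω, ‖((1 - β) • m ω + β • (d ω + e ω)) - v ω‖ ^ 2 ∂P ≤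
      (1 - α / 2) * ∫ ω, ‖m ω - v ω‖ ^ 2 ∂P + 6 * β ^ 2 / α *
        (∫ ω, ‖d ω - c' ω‖ ^ 2 ∂P + ∫ ω, ‖c' ω - c ω‖ ^ 2 ∂P + ∫ ω, ‖c ω - m ω‖ ^ 2 ∂P)
        + (1 - α) * β ^ 2 * ∫ ω, ‖e ω‖ ^ 2 ∂P := by
  have hu : MemLp (fun ω => (1 - β) • m ω + β • d ω - v ω) 2 P :=
    ((hm.const_smul (1 - β)).add (hd.const_smul β)).sub hv
  have hbe : MemLp (fun ω => β • e ω) 2 P := he.const_smul β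
  have e1 : ∀ ω, ‖((1 - β) • m ω + β • (d ω + e ω)) - v ω‖ ^ 2
      = ‖((1 - β) • m ω + β • d ω - v ω) + β • e ω‖ ^ 2 := fun ω => by
    congr 2
    module
  simp_rw [e1]
  rw [integral_norm_add_sq_of_orthogonal hu hbe (by
    simp_rw [inner_smul_right]
    rw [integral_const_mul, horth, mul_zero]), mul_add, mul_assoc (1 - α)]
  simp_rw [norm_smul, mul_pow, Real.norm_eq_abs, sq_abs]
  rw [integral_const_mul (β ^ 2)]
  have i0 := (hm.sub hv).integrable_norm_pow two_ne_zero
  have i1 := (hc.sub hm).integrable_norm_pow two_ne_zero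
  have i2 := (hc'.sub hc).integrable_norm_pow two_ne_zero
  have i3 := (hd.sub hc').integrable_norm_pow two_ne_zero
  simp only [Pi.sub_apply] at i0 i1 i2 i3
  gcongr
  have i4 : Integrable (fun ω => ‖d ω - c' ω‖ ^ 2 + ‖c' ω - c ω‖ ^ 2) P := i3.add i2
  have i5 : Integrable (fun ω => ‖d ω - c' ω‖ ^ 2 + ‖c' ω - c ω‖ ^ 2 + ‖c ω - m ω‖ ^ 2) P :=
    i4.add i1
  rw [← integral_add i3 i2, ← integral_add i4 i1]
  simp only [← integral_const_mul]
  rw [← integral_add (i0.const_mul _) (i5.const_mul _)]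
  exact integral_mono ((hu.integrable_norm_pow two_ne_zero).const_mul _)
    ((i0.const_mul _).add (i5.const_mul _)) fun ω => norm_estimator_sq_le h0 h1 β _ _ _ _ _

end Recursion

/-! ### The scalar Lyapunov inequality. -/

section Lyapunov

theorem zeta_nonneg {ρlo ρhi β αP αD L Lt2 : ℝ} (hβ : 0 < β) (hLt : 0 ≤ Lt2) :
    0 ≤ zeta ρlo ρhi β αP αD L Lt2 := by
  unfold zeta
  positivity

/-- The left side is, up to the factor γ³, the coefficient of the squared step length that the four
recursions produce; ζ dominates it since β + 2 ≥ 1 and 144(2β + 5) ≥ 432. -/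
theorem le_zeta {ρlo ρhi β αP αD L Lt2 : ℝ} (hβ : 0 < β) (hLt : 0 ≤ Lt2) :
    ρhi ^ 2 / ρlo ^ 2 * (12 / β ^ 2 * L ^ 2 + 24 / αP ^ 2 * L ^ 2
      + (144 / αD ^ 2 + 36 * β ^ 2 / αD ^ 2) * Lt2
      + 432 * β ^ 2 / (αP ^ 2 * αD ^ 2) * Lt2) ≤ zeta ρlo ρhi β αP αD L Lt2 := by
  have h1 : 24 / αP ^ 2 * L ^ 2 ≤ 24 * (β + 2) / αP ^ 2 * L ^ 2 := by
    gcongr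
    linarith
  have h2 : 432 * β ^ 2 / (αP ^ 2 * αD ^ 2) * Lt2
      ≤ 144 * β ^ 2 * (2 * β + 5) / (αP ^ 2 * αD ^ 2) * Lt2 := by
    gcongr ?_ / (αP ^ 2 * αD ^ 2) * Lt2
    nlinarith [sq_nonneg β, mul_pos hβ (mul_pos hβ hβ)]
  have h3 : (144 / αD ^ 2 + 36 * β ^ 2 / αD ^ 2) * Lt2 = 36 * (β ^ 2 + 4) / αD ^ 2 * Lt2 := by
    ring
  unfold zeta
  rw [h3]
  gcongr

/-- With t = γ√ζ the hypothesis reads γL + t ≤ 1/2. Hence t² ≤ t/2 and t² + γL/2 ≤ 1/4; multiply by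
γ. -/
theorem step_size_bound {ζ L γ : ℝ} (hζ0 : 0 ≤ ζ) (hL : 0 ≤ L) (hγ : 0 ≤ γ)
    (hγL : γ * (2 * L + 2 * √ζ) ≤ 1) : γ ^ 3 * ζ + L / 2 * γ ^ 2 - γ / 4 ≤ 0 := by
  have h3 := Real.sq_sqrt hζ0
  have h4 := Real.sqrt_nonneg ζ
  set t := γ * √ζ with ht
  have ht0 : 0 ≤ t := by positivity
  have h5 : 0 ≤ γ * L := by positivity
  have h6 : 2 * (γ * L) + 2 * t ≤ 1 := by linarith
  have h7 : γ ^ 3 * ζ = γ * t ^ 2 := by rw [ht, mul_pow, h3]; ring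
  have h8 : t ^ 2 + γ * L / 2 - 1 / 4 ≤ 0 := by nlinarith
  rw [h7]
  nlinarith [mul_nonneg hγ (sub_nonneg.2 h8)]

/-- The weight of the squared shift distance in the Lyapunov function. -/
noncomputable def shiftWeight (ρlo ρhi β αP αD L Lt2 γ : ℝ) : ℝ :=
  γ * (ρhi ^ 2 / ρlo ^ 2) * (6 * L ^ 2 + 108 * β ^ 2 * Lt2 / αD ^ 2) * (2 / αP - 1)

theorem shiftWeight_nonneg {ρlo ρhi β αP αD L Lt2 γ : ℝ} (hαP : 0 < αP) (hαP1 : αP ≤ 1)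
    (hLt : 0 ≤ Lt2) (hγ : 0 ≤ γ) : 0 ≤ shiftWeight ρlo ρhi β αP αD L Lt2 γ := by
  have h2 : 0 ≤ 2 / αP - 1 := by
    rw [sub_nonneg, le_div_iff₀ hαP]
    linarith
  unfold shiftWeight
  positivity

/-- The scalar Lyapunov inequality for one layer. `d`, `dX` are the squared distances of the shift
and of consecutive iterates, `A`, `B`, `C` the squared errors of the average momentum, of the
momenta and of the estimators, and primes denote the next iteration. -/
theorem lyapunov_layer {n ρlo ρhi β αP αD L Lt2 γ σ d d' dX A A' B B' C C' : ℝ}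
    (hlo : 0 < ρlo) (hhi : 0 < ρhi) (hβ : 0 < β) (hαP : 0 < αP)
    (hαD : 0 < αD) (hLt : 0 ≤ Lt2) (hL : 0 ≤ L) (hγ : 0 ≤ γ)
    (hγL : γ * (2 * L + 2 * √(zeta ρlo ρhi β αP αD L Lt2)) ≤ 1) (hdX : 0 ≤ dX)
    (hW : d' ≤ (1 - αP / 2) * d + 2 / αP * (γ ^ 2 * dX))
    (hA : A' ≤ (1 - β / 2) * A + 2 / β * (L ^ 2 / ρlo ^ 2 * (γ ^ 2 * dX))
      + β * (L ^ 2 / ρlo ^ 2 * d') + β ^ 2 * (σ ^ 2 * n⁻¹))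
    (hB : B' ≤ (1 - β / 2) * B + 2 / β * (Lt2 / ρlo ^ 2 * (γ ^ 2 * dX))
      + β * (Lt2 / ρlo ^ 2 * d') + β ^ 2 * σ ^ 2)
    (hC : C' ≤ (1 - αD / 2) * C + 6 * β ^ 2 / αD *
      (Lt2 / ρlo ^ 2 * d' + Lt2 / ρlo ^ 2 * (γ ^ 2 * dX) + B) + (1 - αD) * β ^ 2 * σ ^ 2) :
    6 * ρhi ^ 2 / β * γ * A' + 72 * ρhi ^ 2 * β / αD ^ 2 * γ * B' + 6 * ρhi ^ 2 / αD * γ * C'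
      + shiftWeight ρlo ρhi β αP αD L Lt2 γ * d' + 3 * ρhi ^ 2 * γ * (A + C)
      + (L / 2 * γ ^ 2 - γ / 4) * dX ≤
    6 * ρhi ^ 2 / β * γ * A + 72 * ρhi ^ 2 * β / αD ^ 2 * γ * B + 6 * ρhi ^ 2 / αD * γ * C
      + shiftWeight ρlo ρhi β αP αD L Lt2 γ * d
      + 6 * ((1 / n + (1 - αD) * β / αD + 12 * β ^ 2 / αD ^ 2) *
        (σ ^ 2 * ρhi ^ 2 * β * γ)) := by
  -- The total coefficient of `d'` in the weighted recursions for A, B and C, with 108 = 72 + 36.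
  -- The shift weight w = q(2/αP - 1) solves (w + q)(1 - αP/2) = w, so the shift error reproduces
  -- itself.
  set q := γ * (ρhi ^ 2 / ρlo ^ 2) * (6 * L ^ 2 + 108 * β ^ 2 * Lt2 / αD ^ 2) with hq
  have hq0 : 0 ≤ q := by positivity
  have hQ : shiftWeight ρlo ρhi β αP αD L Lt2 γ = q * (2 / αP - 1) := rfl
  rw [hQ]
  have hstep := step_size_bound (zeta_nonneg hβ hLt) hL hγ hγL
  -- The weights of A and C make their decrease exactly 3ρ̄²γ, the cost in the descent estimate. The
  -- weight of B makes its decrease 36ρ̄²β²γ/αD², the amount by which B enters the recursion of C.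
  have hA1 := mul_le_mul_of_nonneg_left hA (show 0 ≤ 6 * ρhi ^ 2 / β * γ by positivity)
  have hB1 := mul_le_mul_of_nonneg_left hB (show 0 ≤ 72 * ρhi ^ 2 * β / αD ^ 2 * γ by positivity)
  have hC1 := mul_le_mul_of_nonneg_left hC (show 0 ≤ 6 * ρhi ^ 2 / αD * γ by positivity)
  have hW1 := mul_le_mul_of_nonneg_left hW (show 0 ≤ q * (2 / αP) by positivity)
  have eA : 6 * ρhi ^ 2 / β * γ * ((1 - β / 2) * A + 2 / β * (L ^ 2 / ρlo ^ 2 * (γ ^ 2 * dX))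
      + β * (L ^ 2 / ρlo ^ 2 * d') + β ^ 2 * (σ ^ 2 * n⁻¹))
      = 6 * ρhi ^ 2 / β * γ * A - 3 * ρhi ^ 2 * γ * A
        + 12 / β ^ 2 * L ^ 2 * (ρhi ^ 2 / ρlo ^ 2) * γ ^ 3 * dX
        + γ * (ρhi ^ 2 / ρlo ^ 2) * (6 * L ^ 2) * d'
        + 6 * (1 / n) * (σ ^ 2 * ρhi ^ 2 * β * γ) := by
    rw [one_div]
    field_simp
    ring
  have eB : 72 * ρhi ^ 2 * β / αD ^ 2 * γ * ((1 - β / 2) * B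
      + 2 / β * (Lt2 / ρlo ^ 2 * (γ ^ 2 * dX)) + β * (Lt2 / ρlo ^ 2 * d') + β ^ 2 * σ ^ 2)
      = 72 * ρhi ^ 2 * β / αD ^ 2 * γ * B - 36 * ρhi ^ 2 * β ^ 2 / αD ^ 2 * γ * B
        + 144 / αD ^ 2 * Lt2 * (ρhi ^ 2 / ρlo ^ 2) * γ ^ 3 * dX
        + γ * (ρhi ^ 2 / ρlo ^ 2) * (72 * β ^ 2 * Lt2 / αD ^ 2) * d'
        + 6 * (12 * β ^ 2 / αD ^ 2) * (σ ^ 2 * ρhi ^ 2 * β * γ) := by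
    field_simp
    ring
  have eC : 6 * ρhi ^ 2 / αD * γ * ((1 - αD / 2) * C + 6 * β ^ 2 / αD *
      (Lt2 / ρlo ^ 2 * d' + Lt2 / ρlo ^ 2 * (γ ^ 2 * dX) + B) + (1 - αD) * β ^ 2 * σ ^ 2)
      = 6 * ρhi ^ 2 / αD * γ * C - 3 * ρhi ^ 2 * γ * C + 36 * ρhi ^ 2 * β ^ 2 / αD ^ 2 * γ * B
        + 36 * β ^ 2 / αD ^ 2 * Lt2 * (ρhi ^ 2 / ρlo ^ 2) * γ ^ 3 * dX
        + γ * (ρhi ^ 2 / ρlo ^ 2) * (36 * β ^ 2 * Lt2 / αD ^ 2) * d'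
        + 6 * ((1 - αD) * β / αD) * (σ ^ 2 * ρhi ^ 2 * β * γ) := by
    field_simp
    ring
  have eW : q * (2 / αP) * ((1 - αP / 2) * d + 2 / αP * (γ ^ 2 * dX))
      = q * (2 / αP - 1) * d + (ρhi ^ 2 / ρlo ^ 2) * (24 / αP ^ 2 * L ^ 2
        + 432 * β ^ 2 / (αP ^ 2 * αD ^ 2) * Lt2) * γ ^ 3 * dX := by
    rw [hq]
    field_simp
    ring
  have eq' : γ * (ρhi ^ 2 / ρlo ^ 2) * (6 * L ^ 2) * d'
      + γ * (ρhi ^ 2 / ρlo ^ 2) * (72 * β ^ 2 * Lt2 / αD ^ 2) * d'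
      + γ * (ρhi ^ 2 / ρlo ^ 2) * (36 * β ^ 2 * Lt2 / αD ^ 2) * d' = q * d' := by
    rw [hq]
    ring
  have hζle := le_zeta (ρlo := ρlo) (ρhi := ρhi) (αP := αP) (αD := αD) (L := L) hβ hLt
  have hζ1 := mul_le_mul_of_nonneg_right hζle (show 0 ≤ γ ^ 3 * dX by positivity)
  have hs1 := mul_le_mul_of_nonneg_right hstep hdX
  rw [eA] at hA1
  rw [eB] at hB1
  rw [eC] at hC1
  rw [eW] at hW1
  linarith

end Lyapunov

/-! ### Measurability of the iteration maps. -/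

section Measurability

variable {n p : ℕ} {a b : Fin p → ℕ} {Ω : Type*} {m : MeasurableSpace Ω}

theorem measurable_toLp_layers {v : ∀ i, Ω → Layer (a i) (b i)} (h : ∀ i, Measurable (v i)) :
    Measurable fun ω => (WithLp.toLp 2 fun i => v i ω : Params a b) :=
  (WithLp.measurable_toLp 2 _).comp (measurable_pi_lambda _ h)

theorem measurable_layer {x : Ω → Params a b} (h : Measurable x) (i : Fin p) :
    Measurable fun ω => x ω i :=
  (measurable_pi_apply i).comp ((WithLp.measurable_ofLp 2 _).comp h)

theorem measurable_workerAvg {V : Ω → Fin n → Params a b} (hV : ∀ j, Measurable fun ω => V ω j)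
    (i : Fin p) : Measurable fun ω => workerAvg (V ω) i := by
  simp_rw [workerAvg_apply]
  exact (Finset.measurable_fun_sum _ fun j _ => measurable_layer (hV j) i).fun_const_smul (n : ℝ)⁻¹

theorem measurable_compress {Θ : Type*} [MeasurableSpace Θ]
    {C : ∀ i, Layer (a i) (b i) → Θ → Layer (a i) (b i)}
    (hC : ∀ i, Measurable (Function.uncurry (C i))) {x w : Ω → Params a b} {θ : Ω → Θ}
    (hx : Measurable x) (hw : Measurable w) (hθ : Measurable θ) :
    Measurable fun ω => nextW (fun i x => C i x (θ ω)) (x ω) (w ω) :=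
  measurable_toLp_layers fun i => (measurable_layer hw i).add
    ((hC i).comp (((measurable_layer hx i).sub (measurable_layer hw i)).prodMk hθ))

theorem measurable_nextM {β : Fin p → ℝ} {x v : Ω → Params a b} (hx : Measurable x)
    (hv : Measurable v) : Measurable fun ω => nextM β (x ω) (v ω) :=
  measurable_toLp_layers fun i => ((measurable_layer hx i).fun_const_smul (1 - β i)).add
    ((measurable_layer hv i).fun_const_smul (β i))

/-- Measurability of the components of a random state. -/
structure IsMeasurableState (m : MeasurableSpace Ω) (s : Ω → State n a b) : Prop where
  X : Measurable[m] fun ω => (s ω).X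
  W : Measurable[m] fun ω => (s ω).W
  M : ∀ j, Measurable[m] fun ω => (s ω).M j
  G : ∀ j, Measurable[m] fun ω => (s ω).G j

theorem IsMeasurableState.mono {m' : MeasurableSpace Ω} (h : m ≤ m') {s : Ω → State n a b}
    (hs : IsMeasurableState m s) : IsMeasurableState m' s :=
  ⟨hs.X.mono h le_rfl, hs.W.mono h le_rfl, fun j => (hs.M j).mono h le_rfl,
    fun j => (hs.G j).mono h le_rfl⟩

theorem IsMeasurableState.nextX {sharp : ∀ i, Layer (a i) (b i) → Layer (a i) (b i)}
    (hsharp : ∀ i, Measurable (sharp i)) (γ : Fin p → ℝ) {s : Ω → State n a b}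
    (hs : IsMeasurableState m s) : Measurable[m] fun ω => nextX sharp γ (s ω) :=
  measurable_toLp_layers fun i => (measurable_layer hs.X i).sub
    (((hsharp i).comp (measurable_workerAvg hs.G i)).fun_const_smul (γ i))

end Measurability

/-! ### Standing assumptions, filtration and moments of gradients. -/

section Setting

variable {n p : ℕ} {a b : Fin p → ℕ}

/-- The assumptions on the norms, the objective, the gradient oracles and the sharp operators. -/
structure Setting (N : ∀ i, Seminorm ℝ (Layer (a i) (b i))) (ρlo ρhi : Fin p → ℝ)
    (f : Fin n → Params a b → ℝ) (L : Fin p → ℝ) (Lloc : Fin n → Fin p → ℝ)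
    {Ξ : Fin n → Type*} [∀ j, MeasurableSpace (Ξ j)] (D : ∀ j, Measure (Ξ j))
    (g : ∀ j, Params a b → Ξ j → Params a b) (σ : Fin p → ℝ)
    (sharp : ∀ i, Layer (a i) (b i) → Layer (a i) (b i)) : Prop where
  n_pos : 0 < n
  lo_pos : ∀ i, 0 < ρlo i
  hi_pos : ∀ i, 0 < ρhi i
  lo_le : ∀ i x, ρlo i * N i x ≤ ‖x‖
  le_hi : ∀ i x, ‖x‖ ≤ ρhi i * N i x
  smooth : LayerwiseSmooth N L (avgLoss f)
  smooth_loc : ∀ j, LayerwiseSmooth N (Lloc j) (f j)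
  oracle : ∀ j, IsStochasticGradient (D j) σ (f j) (g j)
  isSharp : ∀ i, IsSharpOperator (N i) (sharp i)
  measurable_sharp : ∀ i, Measurable (sharp i)

/-- The seeds and samples of one iteration are fresh: `m₀` is the past, `m₁` adds the server
seed, `m₂` adds the samples, and `mξ j` adds the samples of all workers but `j`. -/
structure IsFresh {Ω ΘP ΘD : Type*} {Ξ : Fin n → Type*} [MeasurableSpace ΘP] [MeasurableSpace ΘD]
    [∀ j, MeasurableSpace (Ξ j)] (m₀ m₁ m₂ : MeasurableSpace Ω) (mξ : Fin n → MeasurableSpace Ω)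
    [mΩ : MeasurableSpace Ω] (P : Measure Ω) (D : ∀ j, Measure (Ξ j))
    (θP : Ω → ΘP) (θD : Ω → ΘD) (ξ : ∀ j, Ω → Ξ j) : Prop where
  le_zero_one : m₀ ≤ m₁
  le_one_xi : ∀ j, m₁ ≤ mξ j
  le_one_two : m₁ ≤ m₂
  le_one : m₁ ≤ mΩ
  le_xi : ∀ j, mξ j ≤ mΩ
  le_two : m₂ ≤ mΩ
  server : Measurable[m₁] θP
  sample : ∀ j, Measurable[m₂] (ξ j)
  sample_ne : ∀ j l, l ≠ j → Measurable[mξ j] (ξ l)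
  worker : Measurable[mΩ] θD
  law : ∀ j, P.map (ξ j) = D j
  indep_server : Indep m₀ (MeasurableSpace.comap θP inferInstance) P
  indep_sample : ∀ j, Indep (mξ j) (MeasurableSpace.comap (ξ j) inferInstance) P
  indep_worker : Indep m₂ (MeasurableSpace.comap θD inferInstance) P

/-- All layers of a random state are square integrable. -/
structure IsSquareIntegrable {Ω : Type*} [MeasurableSpace Ω] (P : Measure Ω)
    (s : Ω → State n a b) : Prop where
  X : ∀ i, MemLp (fun ω => (s ω).X i) 2 P
  W : ∀ i, MemLp (fun ω => (s ω).W i) 2 P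
  M : ∀ j i, MemLp (fun ω => (s ω).M j i) 2 P
  G : ∀ j i, MemLp (fun ω => (s ω).G j i) 2 P

theorem indepFun_of_measurable {Ω Θ F : Type*} [MeasurableSpace Θ] [MeasurableSpace F]
    [MeasurableSpace Ω] {P : Measure Ω} {m : MeasurableSpace Ω} {Y : Ω → F} {θ : Ω → Θ}
    (h : Indep m (MeasurableSpace.comap θ inferInstance) P) (hY : Measurable[m] Y) :
    IndepFun Y θ P :=
  (IndepFun_iff_Indep _ _ _).2 (indep_of_indep_of_le_left h hY.comap_le)

variable {N : ∀ i, Seminorm ℝ (Layer (a i) (b i))} {ρlo ρhi : Fin p → ℝ}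
    {f : Fin n → Params a b → ℝ} {L : Fin p → ℝ} {Lloc : Fin n → Fin p → ℝ}
    {Ξ : Fin n → Type*} [∀ j, MeasurableSpace (Ξ j)] {D : ∀ j, Measure (Ξ j)}
    {g : ∀ j, Params a b → Ξ j → Params a b} {σ : Fin p → ℝ}
    {sharp : ∀ i, Layer (a i) (b i) → Layer (a i) (b i)}
    {Ω : Type*} [MeasurableSpace Ω] {P : Measure Ω}

theorem memLp_layers {x : Ω → Params a b} (h : MemLp x 2 P) (i : Fin p) :
    MemLp (fun ω => x ω i) 2 P :=
  h.of_le (by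
      have : Continuous fun x : Params a b => x i := by fun_prop
      exact this.comp_aestronglyMeasurable h.aestronglyMeasurable)
    (Filter.Eventually.of_forall fun ω => PiLp.norm_apply_le (x ω) i)

theorem Setting.continuous_blockGrad_loc (S : Setting N ρlo ρhi f L Lloc D g σ sharp) (j : Fin n)
    (i : Fin p) : Continuous (blockGrad (f j) i) :=
  (S.smooth_loc j).continuous_blockGrad S.lo_pos (fun i => (S.hi_pos i).le) S.lo_le S.le_hi i

theorem Setting.continuous_blockGrad (S : Setting N ρlo ρhi f L Lloc D g σ sharp) (i : Fin p) :
    Continuous (blockGrad (avgLoss f) i) :=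
  S.smooth.continuous_blockGrad S.lo_pos (fun i => (S.hi_pos i).le) S.lo_le S.le_hi i

theorem Setting.norm_sub_loc_le (S : Setting N ρlo ρhi f L Lloc D g σ sharp) (j : Fin n)
    (i : Fin p) (x y : Params a b) : ‖blockGrad (f j) i x - blockGrad (f j) i y‖ ^ 2
      ≤ Lloc j i ^ 2 / ρlo i ^ 2 * N i (x i - y i) ^ 2 :=
  (S.smooth_loc j).norm_sub_le S.lo_pos (fun i => (S.hi_pos i).le) S.lo_le S.le_hi i x y

theorem Setting.norm_sub_le (S : Setting N ρlo ρhi f L Lloc D g σ sharp)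
    (i : Fin p) (x y : Params a b) : ‖blockGrad (avgLoss f) i x - blockGrad (avgLoss f) i y‖ ^ 2
      ≤ L i ^ 2 / ρlo i ^ 2 * N i (x i - y i) ^ 2 :=
  S.smooth.norm_sub_le S.lo_pos (fun i => (S.hi_pos i).le) S.lo_le S.le_hi i x y

theorem memLp_workerAvg {V : Ω → Fin n → Params a b} {i : Fin p}
    (h : ∀ j, MemLp (fun ω => V ω j i) 2 P) : MemLp (fun ω => workerAvg (V ω) i) 2 P := by
  simp_rw [workerAvg_apply]
  exact (memLp_finsetSum _ fun j _ => h j).const_smul (n : ℝ)⁻¹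

variable [IsProbabilityMeasure P]

/-- Compare with the gradient at 0. Layer-wise smoothness bounds the difference by layer `i` alone,
so only that layer needs a second moment. -/
theorem Setting.memLp_blockGrad_loc (S : Setting N ρlo ρhi f L Lloc D g σ sharp) (j : Fin n)
    (i : Fin p) {x : Ω → Params a b} (hx : Measurable x) (hx2 : MemLp (fun ω => x ω i) 2 P) :
    MemLp (fun ω => blockGrad (f j) i (x ω)) 2 P := by
  have h1 : Measurable fun ω => blockGrad (f j) i (x ω) :=
    (S.continuous_blockGrad_loc j i).measurable.comp hx
  have h2 : MemLp (fun ω => blockGrad (f j) i (x ω) - blockGrad (f j) i 0) 2 P := by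
    rw [memLp_two_iff_integrable_sq_norm (h1.sub_const _).aestronglyMeasurable]
    refine ((integrable_seminorm_sq (S.lo_pos i) (S.lo_le i) hx2).const_mul
      (Lloc j i ^ 2 / ρlo i ^ 2)).mono'
      ((h1.sub_const _).norm.pow_const 2).aestronglyMeasurable
      (Filter.Eventually.of_forall fun ω => ?_)
    rw [Real.norm_of_nonneg (by positivity)]
    simpa using S.norm_sub_loc_le j i (x ω) 0
  refine (h2.add (memLp_const (blockGrad (f j) i 0))).congr_norm h1.aestronglyMeasurable
    (Filter.Eventually.of_forall fun ω => ?_)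
  simp

theorem Setting.blockGrad_avgLoss (S : Setting N ρlo ρhi f L Lloc D g σ sharp) (i : Fin p)
    (x : Params a b) :
    blockGrad (avgLoss f) i x = (n : ℝ)⁻¹ • ∑ j, blockGrad (f j) i x :=
  EFMuon.blockGrad_avgLoss (fun j => (S.smooth_loc j).1) i x

theorem Setting.memLp_blockGrad (S : Setting N ρlo ρhi f L Lloc D g σ sharp)
    (i : Fin p) {x : Ω → Params a b} (hx : Measurable x) (hx2 : MemLp (fun ω => x ω i) 2 P) :
    MemLp (fun ω => blockGrad (avgLoss f) i (x ω)) 2 P := by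
  simp_rw [S.blockGrad_avgLoss]
  exact (memLp_finsetSum _ fun j _ => S.memLp_blockGrad_loc j i hx hx2).const_smul (n : ℝ)⁻¹

/-- The error of the stochastic gradient of worker `j` in layer `i`. -/
noncomputable def gradNoise (f : Fin n → Params a b → ℝ) (g : ∀ j, Params a b → Ξ j → Params a b)
    (j : Fin n) (i : Fin p) (w : Params a b) (t : Ξ j) : Layer (a i) (b i) :=
  g j w t i - blockGrad (f j) i w

theorem Setting.measurable_gradNoise (S : Setting N ρlo ρhi f L Lloc D g σ sharp) (j : Fin n)
    (i : Fin p) : Measurable (Function.uncurry (gradNoise f g j i)) :=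
  (measurable_layer (S.oracle j).1 i).sub
    ((S.continuous_blockGrad_loc j i).measurable.comp measurable_fst)

theorem Setting.integral_gradNoise (S : Setting N ρlo ρhi f L Lloc D g σ sharp) (j : Fin n)
    (i : Fin p) [IsProbabilityMeasure (D j)] (w : Params a b) :
    Integrable (gradNoise f g j i w) (D j) ∧ ∫ t, gradNoise f g j i w t ∂(D j) = 0 := by
  obtain ⟨h1, h2⟩ := ((S.oracle j).2 w).1
  have h3 : Integrable (fun t => g j w t i) (D j) :=
    (PiLp.proj 2 (𝕜 := ℝ) (fun i => Layer (a i) (b i)) i).integrable_comp h1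
  refine ⟨h3.sub (integrable_const _), ?_⟩
  unfold gradNoise
  rw [integral_sub h3 (integrable_const _), integral_const, probReal_univ, one_smul]
  have h4 := (PiLp.proj 2 (𝕜 := ℝ) (fun i => Layer (a i) (b i)) i).integral_comp_comm h1
  rw [h2] at h4
  simp only [PiLp.proj_apply] at h4
  rw [h4]
  simp [blockGrad]

end Setting

/-! ### Descent of the objective, gradient noise and one compression. -/

section Step

variable {n p : ℕ} {a b : Fin p → ℕ}
    {N : ∀ i, Seminorm ℝ (Layer (a i) (b i))} {ρlo ρhi : Fin p → ℝ}
    {f : Fin n → Params a b → ℝ} {L : Fin p → ℝ} {Lloc : Fin n → Fin p → ℝ}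
    {Ξ : Fin n → Type*} [∀ j, MeasurableSpace (Ξ j)] {D : ∀ j, Measure (Ξ j)}
    {g : ∀ j, Params a b → Ξ j → Params a b} {σ : Fin p → ℝ}
    {sharp : ∀ i, Layer (a i) (b i) → Layer (a i) (b i)}
    {Ω : Type*} {m m₀ m₁ m₂ : MeasurableSpace Ω} {mξ : Fin n → MeasurableSpace Ω}
    [mΩ : MeasurableSpace Ω] {P : Measure Ω}

theorem Setting.memLp_sharp (S : Setting N ρlo ρhi f L Lloc D g σ sharp) (i : Fin p)
    {x : Ω → Layer (a i) (b i)} (hx : MemLp x 2 P) (hxm : Measurable x) :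
    MemLp (fun ω => sharp i (x ω)) 2 P :=
  hx.of_le_mul (c := ρhi i ^ 2) ((S.measurable_sharp i).comp hxm).aestronglyMeasurable
    (Filter.Eventually.of_forall fun ω =>
      (S.isSharp i).norm_le (S.hi_pos i).le (S.le_hi i) (x ω))

theorem Setting.memLp_nextX (S : Setting N ρlo ρhi f L Lloc D g σ sharp) (γ : Fin p → ℝ)
    {s : Ω → State n a b} (hs : IsMeasurableState mΩ s) (hs2 : IsSquareIntegrable P s)
    (i : Fin p) : MemLp (fun ω => nextX sharp γ (s ω) i) 2 P :=
  (hs2.X i).sub ((S.memLp_sharp i (memLp_workerAvg fun j => hs2.G j i)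
    (measurable_workerAvg hs.G i)).const_smul (γ i))

/-- The bound for the change of the objective that is due to layer `i`. -/
noncomputable def layerChange (N : ∀ i, Seminorm ℝ (Layer (a i) (b i))) (ρhi : Fin p → ℝ)
    (f : Fin n → Params a b → ℝ) (L γ : Fin p → ℝ)
    (sharp : ∀ i, Layer (a i) (b i) → Layer (a i) (b i)) (i : Fin p) (s : State n a b) : ℝ :=
  -(γ i / 4) * dualNorm (N i) (blockGrad (avgLoss f) i s.X) ^ 2
    + (L i / 2 * γ i ^ 2 - γ i / 4) * N i (sharp i (workerAvg s.G i)) ^ 2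
    + 3 * ρhi i ^ 2 * γ i * (‖blockGrad (avgLoss f) i s.X - workerAvg s.M i‖ ^ 2
      + (n : ℝ)⁻¹ * ∑ j, ‖s.M j i - s.G j i‖ ^ 2)

/-- The one-step decrease of the objective, with the errors of the momentum and of the
estimators. -/
theorem Setting.descent (S : Setting N ρlo ρhi f L Lloc D g σ sharp) {γ : Fin p → ℝ}
    (hγ : ∀ i, 0 ≤ γ i) (s : State n a b) :
    avgLoss f (nextX sharp γ s)
      ≤ avgLoss f s.X + ∑ i, layerChange N ρhi f L γ sharp i s := by
  have h1 := S.smooth.le_add (fun i => (S.hi_pos i).le) S.le_hi s.X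
    (WithLp.toLp 2 fun i => -(γ i • sharp i (workerAvg s.G i)))
  have h2 : s.X + WithLp.toLp 2 (fun i => -(γ i • sharp i (workerAvg s.G i)))
      = nextX sharp γ s := by
    ext i
    simp [nextX, sub_eq_add_neg]
  rw [h2] at h1
  refine h1.trans (add_le_add le_rfl (Finset.sum_le_sum fun i _ => ?_))
  have h3 := (S.isSharp i).descent (S.hi_pos i).le (S.le_hi i) (blockGrad (avgLoss f) i s.X)
    (workerAvg s.G i)
  simp only [inner_neg_right, inner_smul_right, map_neg_eq_map, map_smul_eq_mul, mul_pow,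
    Real.norm_eq_abs, sq_abs]
  have h4 := mul_le_mul_of_nonneg_left h3 (hγ i)
  -- Splitting the error through the average momentum doubles the constant 3/2 of the sharp-operator
  -- estimate to 3.
  have h5 : ‖blockGrad (avgLoss f) i s.X - workerAvg s.G i‖ ^ 2
      ≤ 2 * (‖blockGrad (avgLoss f) i s.X - workerAvg s.M i‖ ^ 2
        + (n : ℝ)⁻¹ * ∑ j, ‖s.M j i - s.G j i‖ ^ 2) := by
    have e1 : blockGrad (avgLoss f) i s.X - workerAvg s.G i
        = (blockGrad (avgLoss f) i s.X - workerAvg s.M i)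
          + (n : ℝ)⁻¹ • ∑ j, (s.M j i - s.G j i) := by
      rw [workerAvg_apply, workerAvg_apply, Finset.sum_sub_distrib, smul_sub]
      abel
    have h6 := norm_avg_sq_le fun j => s.M j i - s.G j i
    rw [e1]
    calc _ ≤ (‖blockGrad (avgLoss f) i s.X - workerAvg s.M i‖
          + ‖(n : ℝ)⁻¹ • ∑ j, (s.M j i - s.G j i)‖) ^ 2 := by gcongr; exact norm_add_le _ _
      _ ≤ 2 * (‖blockGrad (avgLoss f) i s.X - workerAvg s.M i‖ ^ 2
          + ‖(n : ℝ)⁻¹ • ∑ j, (s.M j i - s.G j i)‖ ^ 2) := add_sq_le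
      _ ≤ _ := by gcongr
  have h7 := mul_le_mul_of_nonneg_left h5
    (show 0 ≤ 3 / 2 * ρhi i ^ 2 * γ i by have := hγ i; positivity)
  unfold layerChange
  linarith

variable [IsProbabilityMeasure P]

theorem Setting.gradNoise_sq (S : Setting N ρlo ρhi f L Lloc D g σ sharp) (hm : m ≤ mΩ)
    {j : Fin n} (i : Fin p) {w : Ω → Params a b} (hw : Measurable[m] w) {ξ : Ω → Ξ j}
    (hξ : Measurable ξ) (hlaw : P.map ξ = D j)
    (hind : Indep m (MeasurableSpace.comap ξ inferInstance) P) :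
    MemLp (fun ω => gradNoise f g j i (w ω) (ξ ω)) 2 P ∧
      ∫ ω, ‖gradNoise f g j i (w ω) (ξ ω)‖ ^ 2 ∂P ≤ σ i ^ 2 := by
  have hw' : Measurable[mΩ] w := hw.mono hm le_rfl
  have hn := S.measurable_gradNoise j i
  have hmeas : Measurable fun ω => gradNoise f g j i (w ω) (ξ ω) := hn.comp (hw'.prodMk hξ)
  rw [memLp_two_iff_integrable_sq_norm hmeas.aestronglyMeasurable]
  have h := IndepFun.integrable_comp_of_nonneg hw' hξ (indepFun_of_measurable hind hw)
    (h := fun z => ‖gradNoise f g j i z.1 z.2‖ ^ 2) (φ := fun _ => σ i ^ 2)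
    (hn.norm.pow_const 2) (fun z => by positivity)
    (fun y => by rw [hlaw]; exact (((S.oracle j).2 y).2 i).1)
    (fun y => by rw [hlaw]; exact (((S.oracle j).2 y).2 i).2)
    measurable_const (integrable_const _)
  simpa using h

theorem Setting.integral_inner_gradNoise (S : Setting N ρlo ρhi f L Lloc D g σ sharp)
    (hm : m ≤ mΩ) {j : Fin n} (i : Fin p) {w : Ω → Params a b} (hw : Measurable[m] w)
    {ξ : Ω → Ξ j} (hξ : Measurable ξ) (hlaw : P.map ξ = D j)
    (hind : Indep m (MeasurableSpace.comap ξ inferInstance) P) {u : Ω → Layer (a i) (b i)}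
    (hu : Measurable[m] u) (hu2 : MemLp u 2 P) :
    ∫ ω, inner ℝ (u ω) (gradNoise f g j i (w ω) (ξ ω)) ∂P = 0 := by
  have : IsProbabilityMeasure (D j) := by
    rw [← hlaw]
    exact Measure.isProbabilityMeasure_map hξ.aemeasurable
  refine integral_inner_noise_eq_zero (hw.mono hm le_rfl) (hu.mono hm le_rfl) hξ
    (indepFun_of_measurable hind (hw.prodMk hu)) (S.measurable_gradNoise j i) ?_ ?_ hu2
    (S.gradNoise_sq hm i hw hξ hlaw hind).1
  · rw [hlaw]
    exact fun y => (S.integral_gradNoise j i y).1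
  · rw [hlaw]
    exact fun y => (S.integral_gradNoise j i y).2

/-- The distance of w + C(x - w) from x is the compression error of x - w. Its second moment is
bounded by contractivity, and adding x back gives square integrability. It serves the server shift
and the worker estimators alike. -/
theorem IsContractiveCompressor.memLp_add {E Θ : Type*} [NormedAddCommGroup E]
    [InnerProductSpace ℝ E] [MeasurableSpace E] [BorelSpace E] [SecondCountableTopology E]
    [MeasurableSpace Θ] {θ : Ω → Θ} {N : Seminorm ℝ E} {r R α : ℝ} (hr : 0 < r)
    (h' : ∀ x, r * N x ≤ ‖x‖) (h : ∀ x, ‖x‖ ≤ R * N x) {C : E → Θ → E}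
    (hC : IsContractiveCompressor (P.map θ) N α C) (hθ : Measurable θ)
    (hind : Indep m (MeasurableSpace.comap θ inferInstance) P) (hm : m ≤ mΩ)
    {x w : Ω → E} (hx : Measurable[m] x) (hw : Measurable[m] w) (hx2 : MemLp x 2 P)
    (hw2 : MemLp w 2 P) :
    MemLp (fun ω => w ω + C (x ω - w ω) (θ ω)) 2 P ∧
      ∫ ω, N (x ω - (w ω + C (x ω - w ω) (θ ω))) ^ 2 ∂P
        ≤ (1 - α) * ∫ ω, N (x ω - w ω) ^ 2 ∂P := by
  have hxw : Measurable[m] fun ω => x ω - w ω := hx.sub hw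
  have hxw' : Measurable[mΩ] fun ω => x ω - w ω := hxw.mono hm le_rfl
  have h1 := hC.integral_le (continuous_seminorm hr h').measurable hθ hxw'
    (indepFun_of_measurable hind hxw) (integrable_seminorm_sq hr h' (hx2.sub hw2))
  have hCm : Measurable fun ω => C (x ω - w ω) (θ ω) := hC.2.1.comp (hxw'.prodMk hθ)
  constructor
  · have h2 := memLp_of_integrable_seminorm_sq h (hCm.sub hxw').aestronglyMeasurable h1.1
    refine (h2.add hx2).congr_norm ((hw.mono hm le_rfl).add hCm).aestronglyMeasurable
      (Filter.Eventually.of_forall fun ω => congrArg norm ?_)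
    simp only [Pi.add_apply, Pi.sub_apply]
    abel
  · refine le_of_eq_of_le ?_ h1.2
    congr 1
    ext ω
    rw [← map_neg_eq_map]
    congr 2
    abel

end Step

/-! ### Momentum and estimator errors after one stochastic gradient step. -/

section WorkerStep

variable {n p : ℕ} {a b : Fin p → ℕ}
    {N : ∀ i, Seminorm ℝ (Layer (a i) (b i))} {ρlo ρhi : Fin p → ℝ}
    {f : Fin n → Params a b → ℝ} {L : Fin p → ℝ} {Lloc : Fin n → Fin p → ℝ}
    {Ξ : Fin n → Type*} [∀ j, MeasurableSpace (Ξ j)] {D : ∀ j, Measure (Ξ j)}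
    {g : ∀ j, Params a b → Ξ j → Params a b} {σ : Fin p → ℝ}
    {sharp : ∀ i, Layer (a i) (b i) → Layer (a i) (b i)}
    {Ω : Type*} {m m₁ : MeasurableSpace Ω} {mξ : Fin n → MeasurableSpace Ω}
    [mΩ : MeasurableSpace Ω] {P : Measure Ω} [IsProbabilityMeasure P]

theorem Setting.integral_blockGrad_loc_sub_le (S : Setting N ρlo ρhi f L Lloc D g σ sharp)
    (j : Fin n) (i : Fin p) {x y : Ω → Params a b} (hx : Measurable x) (hy : Measurable y)
    (hx2 : MemLp (fun ω => x ω i) 2 P) (hy2 : MemLp (fun ω => y ω i) 2 P) :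
    ∫ ω, ‖blockGrad (f j) i (x ω) - blockGrad (f j) i (y ω)‖ ^ 2 ∂P
      ≤ Lloc j i ^ 2 / ρlo i ^ 2 * ∫ ω, N i (x ω i - y ω i) ^ 2 ∂P := by
  rw [← integral_const_mul]
  exact integral_mono (((S.memLp_blockGrad_loc j i hx hx2).sub
    (S.memLp_blockGrad_loc j i hy hy2)).integrable_norm_pow two_ne_zero)
    ((integrable_seminorm_sq (S.lo_pos i) (S.lo_le i) (hx2.sub hy2)).const_mul _)
    fun ω => S.norm_sub_loc_le j i _ _

theorem Setting.integral_blockGrad_sub_le (S : Setting N ρlo ρhi f L Lloc D g σ sharp)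
    (i : Fin p) {x y : Ω → Params a b} (hx : Measurable x) (hy : Measurable y)
    (hx2 : MemLp (fun ω => x ω i) 2 P) (hy2 : MemLp (fun ω => y ω i) 2 P) :
    ∫ ω, ‖blockGrad (avgLoss f) i (x ω) - blockGrad (avgLoss f) i (y ω)‖ ^ 2 ∂P
      ≤ L i ^ 2 / ρlo i ^ 2 * ∫ ω, N i (x ω i - y ω i) ^ 2 ∂P := by
  rw [← integral_const_mul]
  exact integral_mono (((S.memLp_blockGrad i hx hx2).sub
    (S.memLp_blockGrad i hy hy2)).integrable_norm_pow two_ne_zero)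
    ((integrable_seminorm_sq (S.lo_pos i) (S.lo_le i) (hx2.sub hy2)).const_mul _)
    fun ω => S.norm_sub_le i _ _

theorem nextM_oracle_apply {Ξ : Fin n → Type*} {g : ∀ j, Params a b → Ξ j → Params a b}
    (β : Fin p → ℝ) (j : Fin n) (i : Fin p) (x w : Params a b) (t : Ξ j) :
    nextM β x (g j w t) i
      = (1 - β i) • x i + β i • (blockGrad (f j) i w + gradNoise f g j i w t) := by
  simp [nextM, gradNoise]

theorem workerAvg_nextM_oracle (S : Setting N ρlo ρhi f L Lloc D g σ sharp)
    (β : Fin p → ℝ) (i : Fin p) (V : Fin n → Params a b) (w : Params a b) (t : ∀ j, Ξ j) :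
    workerAvg (fun j => nextM β (V j) (g j w (t j))) i
      = (1 - β i) • workerAvg V i + β i • (blockGrad (avgLoss f) i w
        + (n : ℝ)⁻¹ • ∑ j, gradNoise f g j i w (t j)) := by
  rw [workerAvg_apply, workerAvg_apply, S.blockGrad_avgLoss]
  simp_rw [nextM_oracle_apply (f := f)]
  rw [← smul_add, ← Finset.sum_add_distrib, smul_comm (1 - β i), smul_comm (β i), ← smul_add,
    Finset.smul_sum (r := 1 - β i), Finset.smul_sum (r := β i), ← Finset.sum_add_distrib]

/-- The errors of the momentum and of the estimator of one worker in one layer, after the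
stochastic gradient step. -/
theorem Setting.worker_step (S : Setting N ρlo ρhi f L Lloc D g σ sharp) (hm : m ≤ mΩ)
    {β : Fin p → ℝ} {α : ℝ} (hα : 0 < α) (hα1 : α ≤ 1) (i : Fin p) (hβ : 0 < β i)
    (hβ1 : β i ≤ 1) {j : Fin n}
    {x x' w' V G : Ω → Params a b} (hx : Measurable[m] x) (hx' : Measurable[m] x')
    (hw' : Measurable[m] w') (hV : Measurable[m] V) (hG : Measurable[m] G)
    (hx2 : MemLp (fun ω => x ω i) 2 P) (hx'2 : MemLp (fun ω => x' ω i) 2 P)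
    (hw'2 : MemLp (fun ω => w' ω i) 2 P) (hV2 : MemLp (fun ω => V ω i) 2 P)
    (hG2 : MemLp (fun ω => G ω i) 2 P)
    {ξ : Ω → Ξ j} (hξ : Measurable ξ) (hlaw : P.map ξ = D j)
    (hind : Indep m (MeasurableSpace.comap ξ inferInstance) P) :
    MemLp (fun ω => nextM β (V ω) (g j (w' ω) (ξ ω)) i) 2 P ∧
    ∫ ω, ‖blockGrad (f j) i (x' ω) - nextM β (V ω) (g j (w' ω) (ξ ω)) i‖ ^ 2 ∂P ≤
      (1 - β i / 2) * ∫ ω, ‖blockGrad (f j) i (x ω) - V ω i‖ ^ 2 ∂P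
        + 2 / β i * (Lloc j i ^ 2 / ρlo i ^ 2 * ∫ ω, N i (x' ω i - x ω i) ^ 2 ∂P)
        + β i * (Lloc j i ^ 2 / ρlo i ^ 2 * ∫ ω, N i (x' ω i - w' ω i) ^ 2 ∂P)
        + β i ^ 2 * σ i ^ 2 ∧
    (1 - α) * ∫ ω, ‖nextM β (V ω) (g j (w' ω) (ξ ω)) i - G ω i‖ ^ 2 ∂P ≤
      (1 - α / 2) * ∫ ω, ‖V ω i - G ω i‖ ^ 2 ∂P + 6 * β i ^ 2 / α *
        (Lloc j i ^ 2 / ρlo i ^ 2 * ∫ ω, N i (x' ω i - w' ω i) ^ 2 ∂P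
          + Lloc j i ^ 2 / ρlo i ^ 2 * ∫ ω, N i (x' ω i - x ω i) ^ 2 ∂P
          + ∫ ω, ‖blockGrad (f j) i (x ω) - V ω i‖ ^ 2 ∂P)
        + (1 - α) * β i ^ 2 * σ i ^ 2 := by
  simp_rw [nextM_oracle_apply (f := f)]
  have hcont := (S.continuous_blockGrad_loc j i).measurable
  obtain ⟨he, heσ⟩ := S.gradNoise_sq hm i hw' hξ hlaw hind
  have hx0 : Measurable[mΩ] x := hx.mono hm le_rfl
  have hx'0 : Measurable[mΩ] x' := hx'.mono hm le_rfl
  have hw'0 : Measurable[mΩ] w' := hw'.mono hm le_rfl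
  have hc := S.memLp_blockGrad_loc j i hx0 hx2
  have hc' := S.memLp_blockGrad_loc j i hx'0 hx'2
  have hd := S.memLp_blockGrad_loc j i hw'0 hw'2
  have b1 := S.integral_blockGrad_loc_sub_le j i hx'0 hx0 hx'2 hx2
  have b2 := S.integral_blockGrad_loc_sub_le j i hx'0 hw'0 hx'2 hw'2
  simp_rw [norm_sub_rev (blockGrad (f j) i (x' _)) (blockGrad (f j) i (w' _))] at b2
  have hu : Measurable[m] fun ω => (1 - β i) • V ω i + β i • blockGrad (f j) i (w' ω) :=
    ((measurable_layer hV i).fun_const_smul _).add ((hcont.comp hw').fun_const_smul _)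
  have hu2 : MemLp (fun ω => (1 - β i) • V ω i + β i • blockGrad (f j) i (w' ω)) 2 P :=
    (hV2.const_smul (1 - β i)).add (hd.const_smul (β i))
  refine ⟨(hV2.const_smul (1 - β i)).add ((hd.add he).const_smul (β i)), ?_, ?_⟩
  · refine (integral_momentum_le hβ hβ1 hV2 hc hc' hd he
      (S.integral_inner_gradNoise hm i hw' hξ hlaw hind (hu.sub (hcont.comp hx'))
        (hu2.sub hc'))).trans ?_
    gcongr
  · refine (integral_estimator_le hα hα1 hV2 hc hc' hd he hG2
      (S.integral_inner_gradNoise hm i hw' hξ hlaw hind (hu.sub (measurable_layer hG i))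
        (hu2.sub hG2))).trans ?_
    have : 0 ≤ 1 - α := by linarith
    gcongr

/-- The error of the average momentum in one layer, after the stochastic gradient step. -/
theorem Setting.average_step (S : Setting N ρlo ρhi f L Lloc D g σ sharp)
    (hle : ∀ j, m₁ ≤ mξ j) (hm : ∀ j, mξ j ≤ mΩ) {β : Fin p → ℝ} (i : Fin p) (hβ : 0 < β i)
    (hβ1 : β i ≤ 1) {x x' w' : Ω → Params a b} {V : Ω → Fin n → Params a b}
    (hx : Measurable[m₁] x) (hx' : Measurable[m₁] x') (hw' : Measurable[m₁] w')
    (hV : ∀ j, Measurable[m₁] fun ω => V ω j)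
    (hx2 : MemLp (fun ω => x ω i) 2 P) (hx'2 : MemLp (fun ω => x' ω i) 2 P)
    (hw'2 : MemLp (fun ω => w' ω i) 2 P) (hV2 : ∀ j, MemLp (fun ω => V ω j i) 2 P)
    {ξ : ∀ j, Ω → Ξ j} (hξ : ∀ j, Measurable (ξ j)) (hlaw : ∀ j, P.map (ξ j) = D j)
    (hne : ∀ j l, l ≠ j → Measurable[mξ j] (ξ l))
    (hind : ∀ j, Indep (mξ j) (MeasurableSpace.comap (ξ j) inferInstance) P) :
    ∫ ω, ‖blockGrad (avgLoss f) i (x' ω)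
        - workerAvg (fun j => nextM β (V ω j) (g j (w' ω) (ξ j ω))) i‖ ^ 2 ∂P ≤
      (1 - β i / 2) * ∫ ω, ‖blockGrad (avgLoss f) i (x ω) - workerAvg (V ω) i‖ ^ 2 ∂P
        + 2 / β i * (L i ^ 2 / ρlo i ^ 2 * ∫ ω, N i (x' ω i - x ω i) ^ 2 ∂P)
        + β i * (L i ^ 2 / ρlo i ^ 2 * ∫ ω, N i (x' ω i - w' ω i) ^ 2 ∂P)
        + β i ^ 2 * (σ i ^ 2 * (n : ℝ)⁻¹) := by
  have hcont := (S.continuous_blockGrad i).measurable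
  have hn : (0 : ℝ) < n := by exact_mod_cast S.n_pos
  let j₀ : Fin n := ⟨0, S.n_pos⟩
  have hm1 : m₁ ≤ mΩ := (hle j₀).trans (hm j₀)
  have hx0 : Measurable[mΩ] x := hx.mono hm1 le_rfl
  have hx'0 : Measurable[mΩ] x' := hx'.mono hm1 le_rfl
  have hw'0 : Measurable[mΩ] w' := hw'.mono hm1 le_rfl
  have hc := S.memLp_blockGrad i hx0 hx2
  have hc' := S.memLp_blockGrad i hx'0 hx'2
  have hd := S.memLp_blockGrad i hw'0 hw'2
  have b1 := S.integral_blockGrad_sub_le i hx'0 hx0 hx'2 hx2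
  have b2 := S.integral_blockGrad_sub_le i hx'0 hw'0 hx'2 hw'2
  simp_rw [norm_sub_rev (blockGrad (avgLoss f) i (x' _)) (blockGrad (avgLoss f) i (w' _))] at b2
  have hw'j : ∀ j, Measurable[mξ j] w' := fun j => hw'.mono (hle j) le_rfl
  have hej := fun j => S.gradNoise_sq (hm j) i (hw'j j) (hξ j) (hlaw j) (hind j)
  have he : MemLp (fun ω => (n : ℝ)⁻¹ • ∑ j, gradNoise f g j i (w' ω) (ξ j ω)) 2 P :=
    (memLp_finsetSum _ fun j _ => (hej j).1).const_smul (n : ℝ)⁻¹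
  have heσ : ∫ ω, ‖(n : ℝ)⁻¹ • ∑ j, gradNoise f g j i (w' ω) (ξ j ω)‖ ^ 2 ∂P
      ≤ σ i ^ 2 * (n : ℝ)⁻¹ := by
    -- For l ≠ j the noise of worker l is measurable for `mξ j`, which is independent of the sample
    -- of j; hence the two noises are orthogonal.
    rw [integral_norm_avg_sq_of_orthogonal (fun j => (hej j).1) fun j l hl =>
      S.integral_inner_gradNoise (hm j) i (hw'j j) (hξ j) (hlaw j) (hind j)
        ((S.measurable_gradNoise l i).comp ((hw'j j).prodMk (hne j l hl))) (hej l).1]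
    calc _ ≤ ((n : ℝ)⁻¹) ^ 2 * ∑ _j : Fin n, σ i ^ 2 := by
          gcongr with j
          exact (hej j).2
      _ = _ := by
          rw [Finset.sum_const, Finset.card_univ, Fintype.card_fin, nsmul_eq_mul]
          field_simp
  have hu : Measurable[m₁] fun ω => (1 - β i) • workerAvg (V ω) i
      + β i • blockGrad (avgLoss f) i (w' ω) - blockGrad (avgLoss f) i (x' ω) :=
    (((measurable_workerAvg hV i).fun_const_smul _).add ((hcont.comp hw').fun_const_smul _)).sub
      (hcont.comp hx')
  have hVa := memLp_workerAvg hV2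
  have hu2 : MemLp (fun ω => (1 - β i) • workerAvg (V ω) i
      + β i • blockGrad (avgLoss f) i (w' ω) - blockGrad (avgLoss f) i (x' ω)) 2 P :=
    ((hVa.const_smul (1 - β i)).add (hd.const_smul (β i))).sub hc'
  have horth : ∫ ω, inner ℝ ((1 - β i) • workerAvg (V ω) i
      + β i • blockGrad (avgLoss f) i (w' ω) - blockGrad (avgLoss f) i (x' ω))
      ((n : ℝ)⁻¹ • ∑ j, gradNoise f g j i (w' ω) (ξ j ω)) ∂P = 0 := by
    simp_rw [inner_smul_right, inner_sum]
    rw [integral_const_mul, integral_finsetSum _ fun j _ => integrable_inner_of_sq hu2 (hej j).1]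
    refine mul_eq_zero_of_right _ (Finset.sum_eq_zero fun j _ => ?_)
    exact S.integral_inner_gradNoise (hm j) i (hw'j j) (hξ j) (hlaw j) (hind j)
      (hu.mono (hle j) le_rfl) hu2
  simp_rw [workerAvg_nextM_oracle S]
  refine (integral_momentum_le hβ hβ1 hVa hc hc' hd he horth).trans ?_
  gcongr

end WorkerStep

/-! ### Lyapunov decrease over one full iteration. -/

section FullStep

variable {n p : ℕ} {a b : Fin p → ℕ}
    {N : ∀ i, Seminorm ℝ (Layer (a i) (b i))} {ρlo ρhi : Fin p → ℝ}
    {f : Fin n → Params a b → ℝ} {L : Fin p → ℝ} {Lloc : Fin n → Fin p → ℝ}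
    {Ξ : Fin n → Type*} [∀ j, MeasurableSpace (Ξ j)] {D : ∀ j, Measure (Ξ j)}
    {g : ∀ j, Params a b → Ξ j → Params a b} {σ : Fin p → ℝ}
    {sharp : ∀ i, Layer (a i) (b i) → Layer (a i) (b i)}
    {Ω : Type*} {m₀ m₁ m₂ : MeasurableSpace Ω} {mξ : Fin n → MeasurableSpace Ω}
    [mΩ : MeasurableSpace Ω] {P : Measure Ω} [IsProbabilityMeasure P]

/-- Averaging a worker recursion turns the squared local constants `v j` into their mean, and the
constant `q₄` survives because n is positive. -/
theorem avg_affine {n : ℕ} (hn : 0 < n) (u v : Fin n → ℝ) (q₁ q₂ q₃ q₄ r x y : ℝ) :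
    (n : ℝ)⁻¹ * ∑ j, (q₁ * u j + q₂ * (v j / r * x) + q₃ * (v j / r * y) + q₄)
      = q₁ * ((n : ℝ)⁻¹ * ∑ j, u j) + q₂ * ((n : ℝ)⁻¹ * ∑ j, v j) / r * x
        + q₃ * ((n : ℝ)⁻¹ * ∑ j, v j) / r * y + q₄ := by
  have hn' : (n : ℝ) ≠ 0 := by positivity
  simp_rw [Finset.sum_add_distrib, ← Finset.mul_sum, ← Finset.sum_mul, ← Finset.sum_div]
  rw [Finset.sum_const, Finset.card_univ, Fintype.card_fin, nsmul_eq_mul]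
  field_simp

/-- The mean squared error of the average momentum in layer `i`. -/
noncomputable def avgMomentumError (P : Measure Ω) (f : Fin n → Params a b → ℝ)
    (s : Ω → State n a b) (i : Fin p) : ℝ :=
  ∫ ω, ‖blockGrad (avgLoss f) i (s ω).X - workerAvg (s ω).M i‖ ^ 2 ∂P

/-- The mean squared error of the momenta of the workers in layer `i`. -/
noncomputable def momentumError (P : Measure Ω) (f : Fin n → Params a b → ℝ)
    (s : Ω → State n a b) (i : Fin p) : ℝ :=
  (n : ℝ)⁻¹ * ∑ j, ∫ ω, ‖blockGrad (f j) i (s ω).X - (s ω).M j i‖ ^ 2 ∂P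

/-- The mean squared error of the gradient estimators of the workers in layer `i`. -/
noncomputable def estimatorError (P : Measure Ω) (s : Ω → State n a b) (i : Fin p) : ℝ :=
  (n : ℝ)⁻¹ * ∑ j, ∫ ω, ‖(s ω).M j i - (s ω).G j i‖ ^ 2 ∂P

/-- The mean squared error of the shift of the server in layer `i`. -/
noncomputable def shiftError (P : Measure Ω) (N : ∀ i, Seminorm ℝ (Layer (a i) (b i)))
    (s : Ω → State n a b) (i : Fin p) : ℝ :=
  ∫ ω, N i ((s ω).X i - (s ω).W i) ^ 2 ∂P

/-- The mean squared length of the step in layer `i`, for unit step size. -/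
noncomputable def stepLength (P : Measure Ω) (N : ∀ i, Seminorm ℝ (Layer (a i) (b i)))
    (sharp : ∀ i, Layer (a i) (b i) → Layer (a i) (b i)) (s : Ω → State n a b) (i : Fin p) : ℝ :=
  ∫ ω, N i (sharp i (workerAvg (s ω).G i)) ^ 2 ∂P

theorem Setting.integrable_dualNorm_sq (S : Setting N ρlo ρhi f L Lloc D g σ sharp)
    {s : Ω → State n a b} (hs : IsMeasurableState mΩ s) (hs2 : IsSquareIntegrable P s)
    (i : Fin p) :
    Integrable (fun ω => dualNorm (N i) (blockGrad (avgLoss f) i (s ω).X) ^ 2) P := by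
  have h1 := (S.memLp_blockGrad i hs.X (hs2.X i)).integrable_norm_pow two_ne_zero
  refine (h1.const_mul (ρhi i ^ 2)).mono' ?_ (Filter.Eventually.of_forall fun ω => ?_)
  · exact ((((continuous_dualNorm (S.hi_pos i).le (S.le_hi i)).comp
      (S.continuous_blockGrad i)).measurable.comp hs.X).pow_const 2).aestronglyMeasurable
  · rw [Real.norm_of_nonneg (by positivity), ← mul_pow]
    have := dualNorm_nonneg (S.hi_pos i).le (S.le_hi i) (blockGrad (avgLoss f) i (s ω).X)
    gcongr
    exact dualNorm_le_mul_norm (S.hi_pos i).le (S.le_hi i) _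

theorem Setting.integral_descent (S : Setting N ρlo ρhi f L Lloc D g σ sharp) {γ : Fin p → ℝ}
    (hγ : ∀ i, 0 ≤ γ i) {fstar : ℝ} (hfstar : ∀ x, fstar ≤ avgLoss f x) {s : Ω → State n a b}
    (hs : IsMeasurableState mΩ s) (hs2 : IsSquareIntegrable P s)
    (hf : Integrable (fun ω => avgLoss f (s ω).X) P) :
    Integrable (fun ω => avgLoss f (nextX sharp γ (s ω))) P ∧
    ∫ ω, avgLoss f (nextX sharp γ (s ω)) ∂P ≤ ∫ ω, avgLoss f (s ω).X ∂P + ∑ i,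
      (-(γ i / 4) * ∫ ω, dualNorm (N i) (blockGrad (avgLoss f) i (s ω).X) ^ 2 ∂P
        + (L i / 2 * γ i ^ 2 - γ i / 4) * stepLength P N sharp s i
        + 3 * ρhi i ^ 2 * γ i * (avgMomentumError P f s i + estimatorError P s i)) := by
  have i1 := S.integrable_dualNorm_sq hs hs2
  have i2 : ∀ i, Integrable (fun ω => N i (sharp i (workerAvg (s ω).G i)) ^ 2) P := fun i =>
    integrable_seminorm_sq (S.lo_pos i) (S.lo_le i)
      (S.memLp_sharp i (memLp_workerAvg fun j => hs2.G j i) (measurable_workerAvg hs.G i))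
  have i3 : ∀ i, Integrable (fun ω =>
      ‖blockGrad (avgLoss f) i (s ω).X - workerAvg (s ω).M i‖ ^ 2) P := fun i =>
    ((S.memLp_blockGrad i hs.X (hs2.X i)).sub
      (memLp_workerAvg fun j => hs2.M j i)).integrable_norm_pow two_ne_zero
  have i4 : ∀ i j, Integrable (fun ω => ‖(s ω).M j i - (s ω).G j i‖ ^ 2) P := fun i j =>
    ((hs2.M j i).sub (hs2.G j i)).integrable_norm_pow two_ne_zero
  have i5 : ∀ i, Integrable (fun ω => (n : ℝ)⁻¹ * ∑ j, ‖(s ω).M j i - (s ω).G j i‖ ^ 2) P :=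
    fun i => (integrable_finsetSum _ fun j _ => i4 i j).const_mul _
  have i6 : ∀ i, Integrable (fun ω =>
      ‖blockGrad (avgLoss f) i (s ω).X - workerAvg (s ω).M i‖ ^ 2
        + (n : ℝ)⁻¹ * ∑ j, ‖(s ω).M j i - (s ω).G j i‖ ^ 2) P := fun i => (i3 i).add (i5 i)
  have i7 : ∀ i, Integrable (fun ω =>
      -(γ i / 4) * dualNorm (N i) (blockGrad (avgLoss f) i (s ω).X) ^ 2
        + (L i / 2 * γ i ^ 2 - γ i / 4) * N i (sharp i (workerAvg (s ω).G i)) ^ 2) P := fun i =>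
    ((i1 i).const_mul _).add ((i2 i).const_mul _)
  have i8 : ∀ i, Integrable (fun ω => layerChange N ρhi f L γ sharp i (s ω)) P := fun i =>
    (i7 i).add ((i6 i).const_mul (3 * ρhi i ^ 2 * γ i))
  have i9 : Integrable (fun ω => ∑ i, layerChange N ρhi f L γ sharp i (s ω)) P :=
    integrable_finsetSum Finset.univ fun i _ => i8 i
  have hdesc := fun ω => S.descent hγ (s ω)
  have hX : Measurable fun ω => nextX sharp γ (s ω) := hs.nextX S.measurable_sharp γ
  -- No growth condition on `f` is needed: its new value lies between `fstar` and the integrable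
  -- descent bound.
  have hf' : Integrable (fun ω => avgLoss f (nextX sharp γ (s ω))) P := by
    have hup := hf.add i9
    refine ((hup.norm).add (integrable_const |fstar|)).mono'
      (S.smooth.1.continuous.measurable.comp hX).aestronglyMeasurable
      (Filter.Eventually.of_forall fun ω => ?_)
    have h1 := hdesc ω
    have h2 := hfstar (nextX sharp γ (s ω))
    simp only [Pi.add_apply, Real.norm_eq_abs] at h1 ⊢
    refine abs_le.2 ⟨?_, ?_⟩
    · linarith [neg_abs_le fstar, abs_nonneg (avgLoss f (s ω).X
        + ∑ i, layerChange N ρhi f L γ sharp i (s ω))]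
    · exact (h1.trans (le_abs_self _)).trans (le_add_of_nonneg_right (abs_nonneg _))
  refine ⟨hf', ?_⟩
  have e1 : ∀ i, ∫ ω, layerChange N ρhi f L γ sharp i (s ω) ∂P
      = -(γ i / 4) * ∫ ω, dualNorm (N i) (blockGrad (avgLoss f) i (s ω).X) ^ 2 ∂P
        + (L i / 2 * γ i ^ 2 - γ i / 4) * stepLength P N sharp s i
        + 3 * ρhi i ^ 2 * γ i * (avgMomentumError P f s i + estimatorError P s i) := fun i => by
    unfold layerChange
    rw [integral_add (i7 i) ((i6 i).const_mul _), integral_add ((i1 i).const_mul _)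
      ((i2 i).const_mul _), integral_const_mul, integral_const_mul, integral_const_mul,
      integral_add (i3 i) (i5 i), integral_const_mul, integral_finsetSum _ fun j _ => i4 i j]
    rfl
  simp_rw [← e1]
  rw [← integral_finsetSum _ fun i _ => i8 i, ← integral_add hf i9]
  exact integral_mono hf' (hf.add i9) hdesc

/-- The Lyapunov function of the analysis. -/
noncomputable def lyapunov (P : Measure Ω) (N : ∀ i, Seminorm ℝ (Layer (a i) (b i)))
    (f : Fin n → Params a b → ℝ) (fstar : ℝ) (ρlo ρhi β γ : Fin p → ℝ) (αP αD : ℝ)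
    (L : Fin p → ℝ) (Lloc : Fin n → Fin p → ℝ) (s : Ω → State n a b) : ℝ :=
  ∫ ω, avgLoss f (s ω).X ∂P - fstar + ∑ i,
    (6 * ρhi i ^ 2 / β i * γ i * avgMomentumError P f s i
      + 72 * ρhi i ^ 2 * β i / αD ^ 2 * γ i * momentumError P f s i
      + 6 * ρhi i ^ 2 / αD * γ i * estimatorError P s i
      + shiftWeight (ρlo i) (ρhi i) (β i) αP αD (L i) ((n : ℝ)⁻¹ * ∑ j, Lloc j i ^ 2) (γ i)
        * shiftError P N s i)

/-- One iteration of the algorithm decreases the Lyapunov function. -/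
theorem Setting.lyapunov_step (S : Setting N ρlo ρhi f L Lloc D g σ sharp)
    {fstar : ℝ} (hfstar : ∀ x, fstar ≤ avgLoss f x) {αP αD : ℝ} {β γ : Fin p → ℝ}
    (hβ : ∀ i, 0 < β i ∧ β i ≤ 1) (hγ : ∀ i, 0 ≤ γ i)
    (hγL : ∀ i, γ i * (2 * L i + 2 * √(zeta (ρlo i) (ρhi i) (β i) αP αD (L i)
      ((n : ℝ)⁻¹ * ∑ j, Lloc j i ^ 2))) ≤ 1)
    {ΘP ΘD : Type*} [MeasurableSpace ΘP] [MeasurableSpace ΘD] {θP : Ω → ΘP} {θD : Ω → ΘD}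
    {ξ : ∀ j, Ω → Ξ j} (hfresh : IsFresh m₀ m₁ m₂ mξ P D θP θD ξ)
    (hαP : 0 < αP ∧ αP ≤ 1) (hαD : 0 < αD ∧ αD ≤ 1)
    {CP : ∀ i, Layer (a i) (b i) → ΘP → Layer (a i) (b i)}
    {CD : ∀ i, Fin n → Layer (a i) (b i) → ΘD → Layer (a i) (b i)}
    (hCP : ∀ i, IsContractiveCompressor (P.map θP) (N i) αP (CP i))
    (hCD : ∀ i j, IsContractiveCompressor (P.map θD) (fun x => ‖x‖) αD (CD i j))
    {s s' : Ω → State n a b} (hs : IsMeasurableState m₀ s) (hs2 : IsSquareIntegrable P s)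
    (hf : Integrable (fun ω => avgLoss f (s ω).X) P)
    (hs' : ∀ ω, s' ω = step sharp γ β (fun i x => CP i x (θP ω)) (fun i j x => CD i j x (θD ω))
      (fun j x => g j x (ξ j ω)) (s ω)) :
    IsSquareIntegrable P s' ∧ Integrable (fun ω => avgLoss f (s' ω).X) P ∧
      lyapunov P N f fstar ρlo ρhi β γ αP αD L Lloc s'
        + ∑ i, γ i / 4 * ∫ ω, dualNorm (N i) (blockGrad (avgLoss f) i (s ω).X) ^ 2 ∂P
      ≤ lyapunov P N f fstar ρlo ρhi β γ αP αD L Lloc s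
        + ∑ i, 6 * ((1 / (n : ℝ) + (1 - αD) * β i / αD + 12 * β i ^ 2 / αD ^ 2) *
          (σ i ^ 2 * ρhi i ^ 2 * β i * γ i)) := by
  obtain rfl : s' = fun ω => step sharp γ β (fun i x => CP i x (θP ω))
    (fun i j x => CD i j x (θD ω)) (fun j x => g j x (ξ j ω)) (s ω) := funext hs'
  have hm01 := hfresh.le_zero_one
  have hm1 := hfresh.le_one
  have hs0 : IsMeasurableState mΩ s := hs.mono (hm01.trans hm1)
  have hs1 : IsMeasurableState m₁ s := hs.mono hm01
  have hθP : Measurable[mΩ] θP := hfresh.server.mono hm1 le_rfl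
  have hξ : ∀ j, Measurable[mΩ] (ξ j) := fun j => (hfresh.sample j).mono hfresh.le_two le_rfl
  obtain ⟨hf', hdesc⟩ := S.integral_descent hγ hfstar hs0 hs2 hf
  set x' : Ω → Params a b := fun ω => nextX sharp γ (s ω) with hx'def
  have hx'm0 : Measurable[m₀] x' := hs.nextX S.measurable_sharp γ
  have hx'm : Measurable[m₁] x' := hx'm0.mono hm01 le_rfl
  have hx'2 : ∀ i, MemLp (fun ω => x' ω i) 2 P := S.memLp_nextX γ hs0 hs2
  set w' : Ω → Params a b := fun ω => nextW (fun i x => CP i x (θP ω)) (x' ω) (s ω).W with hw'def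
  have hw'm : Measurable[m₁] w' :=
    measurable_compress (fun i => (hCP i).2.1) hx'm hs1.W hfresh.server
  have hW := fun i => (hCP i).memLp_add (S.lo_pos i) (S.lo_le i) (S.le_hi i) hθP
    hfresh.indep_server (hm01.trans hm1) (measurable_layer hx'm0 i) (measurable_layer hs.W i)
    (hx'2 i) (hs2.W i)
  have hw'2 : ∀ i, MemLp (fun ω => w' ω i) 2 P := fun i => (hW i).1
  have hworker := fun i j => S.worker_step (hfresh.le_xi j) hαD.1 hαD.2 i (hβ i).1 (hβ i).2
    (hs1.X.mono (hfresh.le_one_xi j) le_rfl) (hx'm.mono (hfresh.le_one_xi j) le_rfl)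
    (hw'm.mono (hfresh.le_one_xi j) le_rfl) ((hs1.M j).mono (hfresh.le_one_xi j) le_rfl)
    ((hs1.G j).mono (hfresh.le_one_xi j) le_rfl) (hs2.X i) (hx'2 i) (hw'2 i) (hs2.M j i)
    (hs2.G j i) (hξ j) (hfresh.law j) (hfresh.indep_sample j)
  have havg := fun i => S.average_step hfresh.le_one_xi hfresh.le_xi i (hβ i).1 (hβ i).2
    hs1.X hx'm hw'm hs1.M (hs2.X i) (hx'2 i) (hw'2 i) (fun j => hs2.M j i) hξ hfresh.law
    hfresh.sample_ne hfresh.indep_sample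
  have hM'm : ∀ j, Measurable[m₂] fun ω => nextM β ((s ω).M j) (g j (w' ω) (ξ j ω)) := fun j =>
    measurable_nextM ((hs1.M j).mono hfresh.le_one_two le_rfl)
      ((S.oracle j).1.comp ((hw'm.mono hfresh.le_one_two le_rfl).prodMk (hfresh.sample j)))
  -- Worker compressors contract in the Euclidean norm, so both equivalence constants are 1.
  have hG := fun i j => IsContractiveCompressor.memLp_add (N := normSeminorm ℝ (Layer (a i) (b i)))
    (R := 1) one_pos (fun x => (one_mul ‖x‖).le) (fun x => (one_mul ‖x‖).ge) (hCD i j)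
    hfresh.worker hfresh.indep_worker hfresh.le_two (measurable_layer (hM'm j) i)
    (measurable_layer ((hs1.G j).mono hfresh.le_one_two le_rfl) i) (hworker i j).1 (hs2.G j i)
  refine ⟨⟨hx'2, hw'2, fun j i => (hworker i j).1, fun j i => (hG i j).1⟩, hf', ?_⟩
  set s' : Ω → State n a b := fun ω => step sharp γ β (fun i x => CP i x (θP ω))
    (fun i j x => CD i j x (θD ω)) (fun j x => g j x (ξ j ω)) (s ω)
  have hdX : ∀ i, ∫ ω, N i (x' ω i - (s ω).X i) ^ 2 ∂P = γ i ^ 2 * stepLength P N sharp s i :=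
    fun i => by
      rw [stepLength, ← integral_const_mul]
      congr 1
      ext ω
      rw [← mul_pow, map_sub_rev]
      simp [hx'def, nextX, map_smul_eq_mul, mul_pow]
  have hd' : ∀ i, ∫ ω, N i (x' ω i - w' ω i) ^ 2 ∂P = shiftError P N s' i := fun i => rfl
  simp only [hdX, hd'] at hworker havg
  have hd : ∀ i, shiftError P N s' i ≤ (1 - αP / 2) * shiftError P N s i
      + 2 / αP * (γ i ^ 2 * stepLength P N sharp s i) := fun i => by
    rw [← hdX]
    exact (hW i).2.trans (integral_shift_le (S.lo_pos i) (S.lo_le i) hαP.1 hαP.2 (hs2.X i)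
      (hx'2 i) (hs2.W i))
  have hA : ∀ i, avgMomentumError P f s' i ≤ (1 - β i / 2) * avgMomentumError P f s i
      + 2 / β i * (L i ^ 2 / ρlo i ^ 2 * (γ i ^ 2 * stepLength P N sharp s i))
      + β i * (L i ^ 2 / ρlo i ^ 2 * shiftError P N s' i) + β i ^ 2 * (σ i ^ 2 * (n : ℝ)⁻¹) := havg
  have hB : ∀ i, momentumError P f s' i ≤ (1 - β i / 2) * momentumError P f s i
      + 2 / β i * (((n : ℝ)⁻¹ * ∑ j, Lloc j i ^ 2) / ρlo i ^ 2
        * (γ i ^ 2 * stepLength P N sharp s i))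
      + β i * (((n : ℝ)⁻¹ * ∑ j, Lloc j i ^ 2) / ρlo i ^ 2 * shiftError P N s' i)
      + β i ^ 2 * σ i ^ 2 := fun i => by
    refine (mul_le_mul_of_nonneg_left (Finset.sum_le_sum fun j _ => (hworker i j).2.1)
      (by positivity)).trans (le_of_eq ?_)
    rw [avg_affine S.n_pos]
    unfold momentumError
    ring
  have hC : ∀ i, estimatorError P s' i ≤ (1 - αD / 2) * estimatorError P s i
      + 6 * β i ^ 2 / αD * (((n : ℝ)⁻¹ * ∑ j, Lloc j i ^ 2) / ρlo i ^ 2 * shiftError P N s' i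
        + ((n : ℝ)⁻¹ * ∑ j, Lloc j i ^ 2) / ρlo i ^ 2 * (γ i ^ 2 * stepLength P N sharp s i)
        + momentumError P f s i) + (1 - αD) * β i ^ 2 * σ i ^ 2 := fun i => by
    refine (mul_le_mul_of_nonneg_left (Finset.sum_le_sum fun j _ =>
      (hG i j).2.trans (hworker i j).2.2) (by positivity)).trans (le_of_eq ?_)
    -- The estimator and momentum errors are bundled into one term with coefficient 1, to match the
    -- shape of `avg_affine`.
    have e : ∀ j, (1 - αD / 2) * ∫ ω, ‖(s ω).M j i - (s ω).G j i‖ ^ 2 ∂P + 6 * β i ^ 2 / αD *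
        (Lloc j i ^ 2 / ρlo i ^ 2 * shiftError P N s' i
          + Lloc j i ^ 2 / ρlo i ^ 2 * (γ i ^ 2 * stepLength P N sharp s i)
          + ∫ ω, ‖blockGrad (f j) i (s ω).X - (s ω).M j i‖ ^ 2 ∂P)
        + (1 - αD) * β i ^ 2 * σ i ^ 2
        = 1 * ((1 - αD / 2) * ∫ ω, ‖(s ω).M j i - (s ω).G j i‖ ^ 2 ∂P + 6 * β i ^ 2 / αD *
          ∫ ω, ‖blockGrad (f j) i (s ω).X - (s ω).M j i‖ ^ 2 ∂P)
        + 6 * β i ^ 2 / αD * (Lloc j i ^ 2 / ρlo i ^ 2 * shiftError P N s' i)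
        + 6 * β i ^ 2 / αD * (Lloc j i ^ 2 / ρlo i ^ 2 * (γ i ^ 2 * stepLength P N sharp s i))
        + (1 - αD) * β i ^ 2 * σ i ^ 2 := fun j => by ring
    simp_rw [e]
    rw [avg_affine S.n_pos, Finset.sum_add_distrib, ← Finset.mul_sum, ← Finset.mul_sum]
    unfold momentumError estimatorError
    ring
  have hlen : ∀ i, 0 ≤ stepLength P N sharp s i := fun i => integral_nonneg fun ω => sq_nonneg _
  have hlayer := fun i => lyapunov_layer (S.lo_pos i) (S.hi_pos i) (hβ i).1 hαP.1 hαD.1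
    (by positivity) (S.smooth.2 i).1 (hγ i) (hγL i)
    (hlen i) (hd i) (hA i) (hB i) (hC i)
  have hsum := Finset.sum_le_sum fun i (_ : i ∈ Finset.univ) => hlayer i
  have hfs' : ∫ ω, avgLoss f (s' ω).X ∂P = ∫ ω, avgLoss f (nextX sharp γ (s ω)) ∂P := rfl
  unfold lyapunov
  rw [hfs']
  simp only [Finset.sum_add_distrib] at hsum hdesc ⊢
  simp only [neg_mul, Finset.sum_neg_distrib] at hdesc
  linarith

end FullStep

/-! ### Independence and adaptedness of the iterates. -/

section Iterates

variable {n p : ℕ} {a b : Fin p → ℕ}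

/-- The sources of randomness that are used before iteration `k`. -/
def Source.Before (k : ℕ) : Source n → Prop
  | .init => True
  | .server l => l < k
  | .sample l _ => l < k
  | .worker l => l < k

variable {Ω ΘP ΘD : Type*} {Ξ : Fin n → Type*} [MeasurableSpace ΘP] [MeasurableSpace ΘD]
    [∀ j, MeasurableSpace (Ξ j)]

/-- The σ-algebra generated by a set of sources of randomness. -/
@[reducible] def jointAlgebra (M₀ G₀ : Ω → Fin n → Params a b) (θP : ℕ → Ω → ΘP)
    (θD : ℕ → Ω → ΘD) (ξ : ℕ → ∀ j, Ω → Ξ j) (T : Set (Source n)) : MeasurableSpace Ω :=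
  ⨆ t ∈ T, sourceAlgebra M₀ G₀ θP θD ξ t

variable {M₀ G₀ : Ω → Fin n → Params a b} {θP : ℕ → Ω → ΘP} {θD : ℕ → Ω → ΘD}
    {ξ : ℕ → ∀ j, Ω → Ξ j}

theorem jointAlgebra_mono {T T' : Set (Source n)} (h : T ⊆ T') :
    jointAlgebra M₀ G₀ θP θD ξ T ≤ jointAlgebra M₀ G₀ θP θD ξ T' :=
  biSup_mono h

theorem sourceAlgebra_le_joint {T : Set (Source n)} {t : Source n} (h : t ∈ T) :
    sourceAlgebra M₀ G₀ θP θD ξ t ≤ jointAlgebra M₀ G₀ θP θD ξ T :=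
  le_biSup (sourceAlgebra M₀ G₀ θP θD ξ) h

theorem measurable_of_comap_le {α : Type*} [mα : MeasurableSpace α] {m : MeasurableSpace Ω}
    {x : Ω → α} (h : MeasurableSpace.comap x mα ≤ m) : Measurable[m] x :=
  (comap_measurable x).mono h le_rfl

theorem indep_jointAlgebra [mΩ : MeasurableSpace Ω] {P : Measure Ω}
    (hle : ∀ t, sourceAlgebra M₀ G₀ θP θD ξ t ≤ mΩ)
    (hindep : iIndep (sourceAlgebra M₀ G₀ θP θD ξ) P) {T : Set (Source n)} {t : Source n}
    (ht : t ∉ T) :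
    Indep (jointAlgebra M₀ G₀ θP θD ξ T) (sourceAlgebra M₀ G₀ θP θD ξ t) P := by
  have h := indep_iSup_of_disjoint hle hindep (Set.disjoint_singleton_right.2 ht)
  rwa [iSup_singleton] at h

theorem IsMeasurableState.step {m : MeasurableSpace Ω}
    {sharp : ∀ i, Layer (a i) (b i) → Layer (a i) (b i)} (hsharp : ∀ i, Measurable (sharp i))
    (γ β : Fin p → ℝ) {CP : ∀ i, Layer (a i) (b i) → ΘP → Layer (a i) (b i)}
    {CD : ∀ i, Fin n → Layer (a i) (b i) → ΘD → Layer (a i) (b i)}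
    {g : ∀ j, Params a b → Ξ j → Params a b}
    (hCP : ∀ i, Measurable (Function.uncurry (CP i)))
    (hCD : ∀ i j, Measurable (Function.uncurry (CD i j)))
    (hg : ∀ j, Measurable (Function.uncurry (g j)))
    {θP : Ω → ΘP} {θD : Ω → ΘD} {ξ : ∀ j, Ω → Ξ j}
    (hθP : Measurable[m] θP) (hθD : Measurable[m] θD) (hξ : ∀ j, Measurable[m] (ξ j))
    {s : Ω → State n a b} (hs : IsMeasurableState m s) :
    IsMeasurableState m fun ω => EFMuon.step sharp γ β (fun i x => CP i x (θP ω))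
      (fun i j x => CD i j x (θD ω)) (fun j x => g j x (ξ j ω)) (s ω) := by
  have hX := hs.nextX hsharp γ
  have hW := measurable_compress hCP hX hs.W hθP
  have hM := fun j => measurable_nextM (β := β) (hs.M j) ((hg j).comp (hW.prodMk (hξ j)))
  exact ⟨hX, hW, hM, fun j => measurable_compress (fun i => hCD i j) (hM j) (hs.G j) hθD⟩

/-- Disjoint families of independent sources generate independent σ-algebras. Each σ-algebra
collects the past and the seeds already drawn in iteration `k`; the server seed, the sample of `j`
and the worker seed are each absent from the one they must be independent of. -/
theorem isFresh_iteration [mΩ : MeasurableSpace Ω] {P : Measure Ω} {D : ∀ j, Measure (Ξ j)}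
    (hM₀ : Measurable M₀) (hG₀ : Measurable G₀) (hθP : ∀ k, Measurable (θP k))
    (hθD : ∀ k, Measurable (θD k))
    (hξ : ∀ k j, Measurable (ξ (k + 1) j) ∧ P.map (ξ (k + 1) j) = D j)
    (hindep : iIndep (sourceAlgebra M₀ G₀ θP θD ξ) P) (k : ℕ) :
    IsFresh (jointAlgebra M₀ G₀ θP θD ξ {t | t.Before k})
      (jointAlgebra M₀ G₀ θP θD ξ ({t | t.Before k} ∪ {.server k}))
      (jointAlgebra M₀ G₀ θP θD ξ ({t | t.Before k} ∪ {.server k} ∪ Set.range (Source.sample k)))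
      (fun j => jointAlgebra M₀ G₀ θP θD ξ
        ({t | t.Before k} ∪ {.server k} ∪ Source.sample k '' {j}ᶜ)) P D
      (θP k) (θD k) (ξ (k + 1)) := by
  have hle : ∀ t, sourceAlgebra M₀ G₀ θP θD ξ t ≤ mΩ := fun t => by
    cases t with
    | init => exact (hM₀.prodMk hG₀).comap_le
    | server l => exact (hθP l).comap_le
    | sample l j => exact (hξ l j).1.comap_le
    | worker l => exact (hθD l).comap_le
  have hjoint : ∀ T, jointAlgebra M₀ G₀ θP θD ξ T ≤ mΩ := fun T => iSup₂_le fun t _ => hle t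
  exact
  { le_zero_one := jointAlgebra_mono Set.subset_union_left
    le_one_xi := fun j => jointAlgebra_mono Set.subset_union_left
    le_one_two := jointAlgebra_mono Set.subset_union_left
    le_one := hjoint _
    le_xi := fun j => hjoint _
    le_two := hjoint _
    server := measurable_of_comap_le (sourceAlgebra_le_joint (t := .server k) (by simp))
    sample := fun j => measurable_of_comap_le
      (sourceAlgebra_le_joint (t := .sample k j) (by simp))
    sample_ne := fun j l hl => measurable_of_comap_le
      (sourceAlgebra_le_joint (t := .sample k l) (by simp [hl]))
    worker := hθD k
    law := fun j => (hξ k j).2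
    indep_server := indep_jointAlgebra hle hindep (t := .server k) (by simp [Source.Before])
    indep_sample := fun j =>
      indep_jointAlgebra hle hindep (t := .sample k j) (by simp [Source.Before])
    indep_worker := indep_jointAlgebra hle hindep (t := .worker k) (by simp [Source.Before]) }

theorem isMeasurableState_iterate {sharp : ∀ i, Layer (a i) (b i) → Layer (a i) (b i)}
    (hsharp : ∀ i, Measurable (sharp i)) (γ β : Fin p → ℝ)
    {CP : ℕ → ∀ i, Layer (a i) (b i) → ΘP → Layer (a i) (b i)}
    {CD : ℕ → ∀ i, Fin n → Layer (a i) (b i) → ΘD → Layer (a i) (b i)}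
    {g : ∀ j, Params a b → Ξ j → Params a b}
    (hCP : ∀ k i, Measurable (Function.uncurry (CP k i)))
    (hCD : ∀ k i j, Measurable (Function.uncurry (CD k i j)))
    (hg : ∀ j, Measurable (Function.uncurry (g j))) (X₀ : Params a b) (k : ℕ) :
    IsMeasurableState (jointAlgebra M₀ G₀ θP θD ξ {t | t.Before k})
      (iterate sharp γ β CP CD g X₀ M₀ G₀ θP θD ξ k) := by
  induction k with
  | zero =>
    have h : Measurable[jointAlgebra M₀ G₀ θP θD ξ {t | t.Before 0}] fun ω => (M₀ ω, G₀ ω) :=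
      measurable_of_comap_le (sourceAlgebra_le_joint (t := .init) trivial)
    exact ⟨measurable_const, measurable_const, fun j => (measurable_pi_apply j).comp h.fst,
      fun j => (measurable_pi_apply j).comp h.snd⟩
  | succ k ih =>
    refine IsMeasurableState.step hsharp γ β (hCP k) (hCD k) hg
      (measurable_of_comap_le (sourceAlgebra_le_joint (t := .server k) ?_))
      (measurable_of_comap_le (sourceAlgebra_le_joint (t := .worker k) ?_))
      (fun j => measurable_of_comap_le (sourceAlgebra_le_joint (t := .sample k j) ?_))
      (ih.mono (jointAlgebra_mono fun t ht => ?_))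
    · exact k.lt_succ_self
    · exact k.lt_succ_self
    · exact k.lt_succ_self
    · cases t with
      | init => trivial
      | server l => exact Nat.lt_succ_of_lt ht
      | sample l j => exact Nat.lt_succ_of_lt ht
      | worker l => exact Nat.lt_succ_of_lt ht

end Iterates

/-! ### Lower bound and initial value of the Lyapunov function. -/

section Initial

variable {n p : ℕ} {a b : Fin p → ℕ} {Ω : Type*} [MeasurableSpace Ω] {P : Measure Ω}
    [IsProbabilityMeasure P]

theorem lyapunov_nonneg (N : ∀ i, Seminorm ℝ (Layer (a i) (b i))) {f : Fin n → Params a b → ℝ}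
    {fstar : ℝ} (hfstar : ∀ x, fstar ≤ avgLoss f x) (ρlo ρhi : Fin p → ℝ) {β γ : Fin p → ℝ}
    {αP αD : ℝ} (hβ : ∀ i, 0 < β i) (hγ : ∀ i, 0 ≤ γ i) (hαP : 0 < αP ∧ αP ≤ 1) (hαD : 0 < αD)
    (L : Fin p → ℝ) (Lloc : Fin n → Fin p → ℝ) {s : Ω → State n a b}
    (hf : Integrable (fun ω => avgLoss f (s ω).X) P) :
    0 ≤ lyapunov P N f fstar ρlo ρhi β γ αP αD L Lloc s := by
  have h1 : fstar ≤ ∫ ω, avgLoss f (s ω).X ∂P := by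
    simpa using integral_mono (integrable_const fstar) hf fun ω => hfstar (s ω).X
  refine add_nonneg (sub_nonneg.2 h1) (Finset.sum_nonneg fun i _ => ?_)
  have hA : 0 ≤ avgMomentumError P f s i := integral_nonneg fun ω => by positivity
  have hB : 0 ≤ momentumError P f s i :=
    mul_nonneg (by positivity) (Finset.sum_nonneg fun j _ => integral_nonneg fun ω => by positivity)
  have hC : 0 ≤ estimatorError P s i :=
    mul_nonneg (by positivity) (Finset.sum_nonneg fun j _ => integral_nonneg fun ω => by positivity)
  have hd : 0 ≤ shiftError P N s i := integral_nonneg fun ω => by positivity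
  have hQ := shiftWeight_nonneg (ρlo := ρlo i) (ρhi := ρhi i) (β := β i) (αD := αD) (L := L i)
    (Lt2 := (n : ℝ)⁻¹ * ∑ j, Lloc j i ^ 2) hαP.1 hαP.2 (by positivity) (hγ i)
  have := hβ i
  have := hγ i
  positivity

/-- The shift starts at the iterate, so the shift error vanishes and its weight leaves no trace in
Ψ⁰. -/
theorem lyapunov_initial (N : ∀ i, Seminorm ℝ (Layer (a i) (b i))) (f : Fin n → Params a b → ℝ)
    (fstar : ℝ) (ρlo ρhi β γ : Fin p → ℝ) (αP αD : ℝ) (L : Fin p → ℝ) (Lloc : Fin n → Fin p → ℝ)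
    (X₀ : Params a b) (M₀ G₀ : Ω → Fin n → Params a b) :
    lyapunov P N f fstar ρlo ρhi β γ αP αD L Lloc (fun ω => ⟨X₀, X₀, M₀ ω, G₀ ω⟩)
      = lyapunovInit P f fstar ρhi β γ αD X₀ M₀ G₀ := by
  simp only [lyapunov, lyapunovInit, shiftError, avgMomentumError, momentumError, estimatorError,
    sub_self, map_zero, Finset.sum_add_distrib]
  simp
  ring

end Initial

end EFMuon

/-! ### Telescoping and normalization. -/

theorem mainTheorem3 {n p : ℕ} (hn : 0 < n) {a b : Fin p → ℕ}
    -- the layer norms, with their norm equivalence constants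
    (N : ∀ i, Seminorm ℝ (EFMuon.Layer (a i) (b i))) (hN : ∀ i x, N i x = 0 → x = 0)
    (ρlo ρhi : Fin p → ℝ) (hρlo : ∀ i, 0 < ρlo i) (hρhi : ∀ i, 0 < ρhi i)
    (hρ : ∀ i x, ρlo i * N i x ≤ ‖x‖ ∧ ‖x‖ ≤ ρhi i * N i x)
    -- the objective: lower bound and layer-wise smoothness
    (f : Fin n → EFMuon.Params a b → ℝ) (fstar : ℝ) (hfstar : ∀ x, fstar ≤ EFMuon.avgLoss f x)
    (L : Fin p → ℝ) (hL : EFMuon.LayerwiseSmooth N L (EFMuon.avgLoss f))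
    (Lloc : Fin n → Fin p → ℝ) (hLloc : ∀ j, EFMuon.LayerwiseSmooth N (Lloc j) (f j))
    -- the stochastic gradients
    {Ξ : Fin n → Type*} [∀ j, MeasurableSpace (Ξ j)] (D : ∀ j, Measure (Ξ j))
    (g : ∀ j, EFMuon.Params a b → Ξ j → EFMuon.Params a b)
    (σ : Fin p → ℝ) (hσ : ∀ i, 0 ≤ σ i)
    (hg : ∀ j, EFMuon.IsStochasticGradient (D j) σ (f j) (g j))
    -- the randomness of the algorithm
    {Ω : Type*} [MeasurableSpace Ω] (P : Measure Ω) [IsProbabilityMeasure P]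
    {ΘP ΘD : Type*} [MeasurableSpace ΘP] [MeasurableSpace ΘD]
    (θP : ℕ → Ω → ΘP) (θD : ℕ → Ω → ΘD) (ξ : ℕ → ∀ j, Ω → Ξ j)
    (hθP : ∀ k, Measurable (θP k)) (hθD : ∀ k, Measurable (θD k))
    (hξ : ∀ k j, Measurable (ξ (k + 1) j) ∧ P.map (ξ (k + 1) j) = D j)
    (X₀ : EFMuon.Params a b) (M₀ G₀ : Ω → Fin n → EFMuon.Params a b)
    (hM₀ : Measurable M₀) (hM₀2 : ∀ j, MemLp (fun ω => M₀ ω j) 2 P)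
    (hG₀ : Measurable G₀) (hG₀2 : ∀ j, MemLp (fun ω => G₀ ω j) 2 P)
    (hindep : iIndep (EFMuon.sourceAlgebra M₀ G₀ θP θD ξ) P)
    -- the compressors
    (αP αD : ℝ)
    (CP : ℕ → ∀ i, EFMuon.Layer (a i) (b i) → ΘP → EFMuon.Layer (a i) (b i))
    (CD : ℕ → ∀ i, Fin n → EFMuon.Layer (a i) (b i) → ΘD → EFMuon.Layer (a i) (b i))
    (hCP : ∀ k i, EFMuon.IsContractiveCompressor (P.map (θP k)) (N i) αP (CP k i))
    (hCD : ∀ k i j, EFMuon.IsContractiveCompressor (P.map (θD k)) (fun x => ‖x‖) αD (CD k i j))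
    -- the sharp operators
    (sharp : ∀ i, EFMuon.Layer (a i) (b i) → EFMuon.Layer (a i) (b i))
    (hsharp : ∀ i, EFMuon.IsSharpOperator (N i) (sharp i) ∧ Measurable (sharp i))
    -- the momentum parameters and the step sizes; the last hypothesis is
    -- `γ i ≤ 1 / (2 * L i + 2 * √ζ_i)`, where `1 / 0` is read as infinity
    (β γ : Fin p → ℝ) (hβ : ∀ i, 0 < β i ∧ β i ≤ 1) (hγ : ∀ i, 0 ≤ γ i) (hγpos : 0 < ∑ l, γ l)
    (hγL : ∀ i, γ i * (2 * L i + 2 * √(EFMuon.zeta (ρlo i) (ρhi i) (β i) αP αD (L i)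
      ((n : ℝ)⁻¹ * ∑ j, Lloc j i ^ 2))) ≤ 1)
    (K : ℕ) (hK : 1 ≤ K) :
    (∀ k < K, ∀ i, Integrable (fun ω => EFMuon.dualNorm (N i)
      (EFMuon.blockGrad (EFMuon.avgLoss f) i
        (EFMuon.iterate sharp γ β CP CD g X₀ M₀ G₀ θP θD ξ k ω).X) ^ 2) P) ∧
    1 / (K : ℝ) * ∑ k ∈ Finset.range K, ∑ i, γ i / (1 / (p : ℝ) * ∑ l, γ l) *
        ∫ ω, EFMuon.dualNorm (N i) (EFMuon.blockGrad (EFMuon.avgLoss f) i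
          (EFMuon.iterate sharp γ β CP CD g X₀ M₀ G₀ θP θD ξ k ω).X) ^ 2 ∂P
      ≤ 1 / (K : ℝ) *
          (4 * EFMuon.lyapunovInit P f fstar ρhi β γ αD X₀ M₀ G₀ / (1 / (p : ℝ) * ∑ l, γ l))
        + 24 * ∑ i, (1 / (n : ℝ) + (1 - αD) * β i / αD + 12 * β i ^ 2 / αD ^ 2) *
            (σ i ^ 2 * ρhi i ^ 2 * β i * γ i / (1 / (p : ℝ) * ∑ l, γ l)) := by
  have S : EFMuon.Setting N ρlo ρhi f L Lloc D g σ sharp :=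
    ⟨hn, hρlo, hρhi, fun i x => (hρ i x).1, fun i x => (hρ i x).2, hL, hLloc, hg,
      fun i => (hsharp i).1, fun i => (hsharp i).2⟩
  have hp : 0 < p := by
    rcases Nat.eq_zero_or_pos p with rfl | h
    · simp at hγpos
    · exact h
  -- The ranges of αP and αD are part of the compressor hypotheses, so extracting them takes at
  -- least one layer and one worker.
  have hαP := (hCP 0 ⟨0, hp⟩).1
  have hαD := (hCD 0 ⟨0, hp⟩ ⟨0, hn⟩).1
  set s := EFMuon.iterate sharp γ β CP CD g X₀ M₀ G₀ θP θD ξ with hs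
  have hfresh := EFMuon.isFresh_iteration hM₀ hG₀ hθP hθD hξ hindep
  have hmeas := EFMuon.isMeasurableState_iterate (M₀ := M₀) (G₀ := G₀) (θP := θP) (θD := θD)
    (ξ := ξ) (fun i => (hsharp i).2) γ β (fun k i => (hCP k i).2.1) (fun k i j => (hCD k i j).2.1)
    (fun j => (hg j).1) X₀
  -- The step is kept conditional on integrability at `k`, because it also yields integrability at
  -- `k + 1` and thus drives the induction `hinv`.
  have hstep := fun k (h : EFMuon.IsSquareIntegrable P (s k) ∧
      Integrable (fun ω => EFMuon.avgLoss f (s k ω).X) P) =>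
    S.lyapunov_step (s' := s (k + 1)) hfstar hβ hγ hγL (hfresh k) hαP hαD (hCP k) (hCD k) (hmeas k)
      h.1 h.2 fun ω => rfl
  have hinv : ∀ k, EFMuon.IsSquareIntegrable P (s k) ∧
      Integrable (fun ω => EFMuon.avgLoss f (s k ω).X) P := fun k => by
    induction k with
    | zero => exact ⟨⟨fun i => memLp_const (X₀ i), fun i => memLp_const (X₀ i),
        fun j i => EFMuon.memLp_layers (hM₀2 j) i, fun j i => EFMuon.memLp_layers (hG₀2 j) i⟩,
        integrable_const (EFMuon.avgLoss f X₀)⟩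
    | succ k ih => exact ⟨(hstep k ih).1, (hstep k ih).2.1⟩
  have hint := fun k i => S.integrable_dualNorm_sq
    ((hmeas k).mono ((hfresh k).le_zero_one.trans (hfresh k).le_one)) (hinv k).1 i
  refine ⟨fun k _ i => hint k i, ?_⟩
  set T : ℕ → Fin p → ℝ := fun k i =>
    ∫ ω, EFMuon.dualNorm (N i) (EFMuon.blockGrad (EFMuon.avgLoss f) i (s k ω).X) ^ 2 ∂P
  set c : Fin p → ℝ := fun i => (1 / (n : ℝ) + (1 - αD) * β i / αD + 12 * β i ^ 2 / αD ^ 2)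
  set Ψ : ℕ → ℝ := fun k => EFMuon.lyapunov P N f fstar ρlo ρhi β γ αP αD L Lloc (s k)
  have htel : ∀ k, Ψ k + ∑ l ∈ Finset.range k, ∑ i, γ i / 4 * T l i
      ≤ Ψ 0 + k * ∑ i, 6 * (c i * (σ i ^ 2 * ρhi i ^ 2 * β i * γ i)) := fun k => by
    induction k with
    | zero => simp
    | succ k ih =>
      have := (hstep k (hinv k)).2.2
      rw [Finset.sum_range_succ]
      push_cast
      linarith
  have hΨ0 : Ψ 0 = EFMuon.lyapunovInit P f fstar ρhi β γ αD X₀ M₀ G₀ :=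
    EFMuon.lyapunov_initial N f fstar ρlo ρhi β γ αP αD L Lloc X₀ M₀ G₀
  have hΨK : 0 ≤ Ψ K := EFMuon.lyapunov_nonneg N hfstar ρlo ρhi (fun i => (hβ i).1) hγ hαP hαD.1
    L Lloc (hinv K).2
  have hK0 : (0 : ℝ) < K := by exact_mod_cast hK
  have hp0 : (0 : ℝ) < p := by exact_mod_cast hp
  have hmain := htel K
  rw [hΨ0] at hmain
  set B := 1 / (p : ℝ) * ∑ l, γ l
  have hB : 0 < B := by positivity
  -- All three terms are multiples by 4/(K·B) of those in the telescoped inequality, where B is the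
  -- mean step size; it then remains only to discard `Ψ K ≥ 0`.
  have e1 : 1 / (K : ℝ) * ∑ k ∈ Finset.range K, ∑ i, γ i / B * T k i
      = 4 / (K * B) * ∑ k ∈ Finset.range K, ∑ i, γ i / 4 * T k i := by
    simp_rw [Finset.mul_sum]
    refine Finset.sum_congr rfl fun k _ => Finset.sum_congr rfl fun i _ => ?_
    field_simp
  have e2 : 24 * ∑ i, c i * (σ i ^ 2 * ρhi i ^ 2 * β i * γ i / B)
      = 4 / (K * B) * (K * ∑ i, 6 * (c i * (σ i ^ 2 * ρhi i ^ 2 * β i * γ i))) := by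
    simp_rw [Finset.mul_sum]
    refine Finset.sum_congr rfl fun i _ => ?_
    field_simp
    ring
  have e3 : 1 / (K : ℝ) * (4 * EFMuon.lyapunovInit P f fstar ρhi β γ αD X₀ M₀ G₀ / B)
      = 4 / (K * B) * EFMuon.lyapunovInit P f fstar ρhi β γ αD X₀ M₀ G₀ := by
    field_simp
  rw [e1, e2, e3, ← mul_add]
  gcongr
  linarith
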